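/- All graphs are finite and simple. A cubic graph is one in which every vertex has degree $3$; a graph is $2$-connected if it has at least three vertices, is connected, and remains connected after the deletion of any single vertex; it is planar if it can be drawn in the plane, with its vertices as distinct points and its edges as polygonal arcs joining their end vertices, such that no edge contains a vertex other than its two ends and distinct edges meet only at vertices. The cycle spectrum $\mathcal{C}(G)$ of a graph $G$ is the set of lengths of cycles in $G$, and the circumference of $G$ is the length of a longest cycle of $G$. For $a,b\in\mathbb{N}$ with $3\le a\le b$, the interval $[a,b]$ is called a gap of $G$ if $\mathcal{C}(G)\cap[a,b]=\emptyset$ and $G$ has circumference greater than $b$. **Proposition.** Let $a,b\in\mathbb{N}$ with $3\le a\le b$. The interval $[a,b]$ is a gap of some $2$-connected cubic planar graph if and only if one of the following holds: (i) $a=3$ and $b\le 4$; (ii) $a=4$ and $b\le 9$; (iii) $a\ge 5$. -/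

import Mathlib

namespace CycleGaps

/-- `G` is `k`-connected: it has more than `k` vertices, and deleting fewer than `k` vertices
always leaves a connected graph. -/
def IsKConnected {V : Type*} [Fintype V] (k : ℕ) (G : SimpleGraph V) : Prop :=
  k < Fintype.card V ∧
    ∀ S : Finset V, S.card < k → (G.induce ((S : Set V)ᶜ)).Connected

/-- `A` is a (simple) polygonal arc in the plane with end points `p` and `q`: it is the union of
the `n ≥ 1` nondegenerate segments `[c 0, c 1], …, [c (n - 1), c n]` with `c 0 = p` and `c n = q`,
where consecutive segments meet only in their common end point and
nonconsecutive segments are disjoint. -/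
def IsPolygonalArc (A : Set (ℝ × ℝ)) (p q : ℝ × ℝ) : Prop :=
  ∃ (n : ℕ) (c : ℕ → ℝ × ℝ), 0 < n ∧ c 0 = p ∧ c n = q ∧
    (∀ i, i < n → c i ≠ c (i + 1)) ∧
    (∀ i, i + 1 < n →
      segment ℝ (c i) (c (i + 1)) ∩ segment ℝ (c (i + 1)) (c (i + 2)) = {c (i + 1)}) ∧
    (∀ i j, i + 1 < j → j < n →
      Disjoint (segment ℝ (c i) (c (i + 1))) (segment ℝ (c j) (c (j + 1)))) ∧
    A = ⋃ i ∈ Set.Iio n, segment ℝ (c i) (c (i + 1))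

/-- `G` is planar: it can be drawn in the plane with distinct points as vertices and with
polygonal arcs between their end vertices as edges (as in Diestel's textbook), such that an edge
contains no vertex other than its two ends and two distinct edges meet only in vertices. -/
def IsPlanar {V : Type*} (G : SimpleGraph V) : Prop :=
  ∃ (pos : V → ℝ × ℝ) (arc : Sym2 V → Set (ℝ × ℝ)),
    Function.Injective pos ∧
    (∀ u v, G.Adj u v → IsPolygonalArc (arc s(u, v)) (pos u) (pos v)) ∧
    (∀ u v w, G.Adj u v → pos w ∈ arc s(u, v) → w = u ∨ w = v) ∧
    (∀ e ∈ G.edgeSet, ∀ f ∈ G.edgeSet, e ≠ f → arc e ∩ arc f ⊆ Set.range pos)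

/-- The set of lengths of cycles in `G`. -/
def cycleSpectrum {V : Type*} (G : SimpleGraph V) : Set ℕ :=
  {n | ∃ (v : V) (c : G.Walk v v), c.IsCycle ∧ c.length = n}

/-- The length of a longest cycle in the finite graph `G` (`0` if there is no cycle). -/
noncomputable def circumference {V : Type*} [Fintype V] (G : SimpleGraph V) : ℕ :=
  sSup (cycleSpectrum G)

/-- `[a, b]` is a gap of `G`. -/
def IsGap {V : Type*} [Fintype V] (G : SimpleGraph V) (a b : ℕ) : Prop :=
  cycleSpectrum G ∩ Set.Icc a b = ∅ ∧ b < circumference G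

end CycleGaps

/-!
Necessity. A 2-connected cubic planar graph `G` has a cycle of length at most `5`, and a cycle of
length between `4` and `10`. Both follow by counting from two facts about plane drawings: Euler's
inequality `V - E + F ≥ 1`, and that facial walks are cycles. No topology of the plane is needed
for these facts. What replaces the Jordan curve theorem is the following property of a polygonal
drawing (`IsPlaneRotation`): for the counterclockwise rotation of the darts at each vertex, every
real flow `C` on `G` has a potential, that is, a function on the facial walks whose jump across
each dart `d` is `C d`.

The potential comes from winding numbers. Let `M x` be the sum over all segments of the drawing of
the angle under which the segment is seen from `x`, weighted with the flow; for a directed cycle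
this is `2π` times the winding number. Where a point moves along a segment of the drawing, `M`
(with the angle of that segment itself set to `0`) has derivative zero, since the contributions of
the end points of the segments cancel by flow conservation (`sum_dirAngle_eq`). Hence `M` has a
well-defined value on each arc. The values to the left and to the right of a dart `d` are
obtained from it by adding `± π * C d`, and an elementary computation at a vertex shows that the
values on both boundary arcs of a sector match (`sector_eq`).

Given the potentials, the linear map from functions on faces, vertices and edges to functions on
darts in `IsPlaneRotation.dartMap_surjective` is surjective, because a functional that vanishes on
its image is a flow orthogonal to itself; comparing dimensions gives Euler's inequality
(`IsPlaneRotation.card_lt`). In a 2-connected graph, each edge carries a nonzero flow, so its two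
sides lie in different faces and facial walks are cycles (`IsPlaneRotation.faceLength_mem`). By
Euler's inequality, it is impossible to distribute the `2 * E = 3 * V` darts to the faces so that
each face gets at least six. If all cycles had length at least six, giving each dart to the
face on its left would do so. If there were no cycles of lengths `4, …, 10`, the darts
on the far side of the triangular faces could be given to the triangles: as there are no
`4`-cycles, a face of length at least `11` is adjacent to triangles in at most half of its edges and
keeps at least six darts
(`IsPlaneRotation.exists_mem_cycleSpectrum_Icc`).

Sufficiency. The dodecahedron has girth five; the truncated dodecahedron has no cycles of lengths
`4, …, 9`; and in a cyclic necklace of `m` diamonds each cycle either stays in one diamond and has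
length at most `4`, or visits all diamonds and has length at least `m`. The last two claims follow
from the parity of the degrees of a cycle. All three graphs are given by a Hamiltonian cycle and
its chords, which yields 2-connectedness and the circumference at once (`IsChordData`), and by a
straight-line drawing in which any two segments lie on different sides of a line that contains at
most one of them.
-/

namespace CycleGaps

open SimpleGraph

/-! ### Cycles from cyclic sequences of vertices -/

theorem exists_path_of_sequence {V : Type*} {G : SimpleGraph V} (f : ℕ → V) (k : ℕ)
    (hadj : ∀ i < k, G.Adj (f i) (f (i + 1))) :
    ∃ p : G.Walk (f 0) (f k), p.length = k ∧ p.support = (List.range (k + 1)).map f ∧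
      p.edges = (List.range k).map fun i => s(f i, f (i + 1)) := by
  induction k with
  | zero => exact ⟨Walk.nil, by simp⟩
  | succ k ih =>
    obtain ⟨p, hl, hs, he⟩ := ih fun i hi => hadj i (by omega)
    refine ⟨p.concat (hadj k (by omega)), by simp [hl], ?_, ?_⟩
    · rw [Walk.support_concat, hs, List.range_succ (n := k + 1)]
      simp
    · rw [Walk.edges_concat, he, List.range_succ (n := k)]
      simp

theorem mem_cycleSpectrum_of_sequence {V : Type*} {G : SimpleGraph V} (f : ℕ → V) {n : ℕ}
    (hn : 3 ≤ n) (hadj : ∀ i < n, G.Adj (f i) (f (i + 1))) (hclosed : f n = f 0)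
    (hinj : Set.InjOn f (Set.Iio n)) : n ∈ cycleSpectrum G := by
  obtain ⟨k, rfl⟩ : ∃ k, n = k + 1 := ⟨n - 1, by omega⟩
  obtain ⟨p, hl, hs, he⟩ := exists_path_of_sequence f k fun i hi => hadj i (by omega)
  have hk : G.Adj (f k) (f 0) := hclosed ▸ hadj k (by omega)
  refine ⟨f k, Walk.cons hk p, ?_, by simp [hl]⟩
  rw [Walk.cons_isCycle_iff, Walk.isPath_def, hs, he]
  refine ⟨List.Nodup.map_on ?_ List.nodup_range, ?_⟩
  · intro i hi j hj h
    exact hinj (by simpa using hi) (by simpa using hj) h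
  · simp only [List.mem_map, List.mem_range, not_exists, not_and]
    intro i hi h
    have key : ∀ a b, a < k + 1 → b < k + 1 → f a = f b → a = b := fun a b ha hb h =>
      hinj ha hb h
    rcases Sym2.eq_iff.1 h with ⟨h1, -⟩ | ⟨h1, h2⟩
    · have := key i k (by omega) (by omega) h1; omega
    · have := key i 0 (by omega) (by omega) h1
      have := key (i + 1) k (by omega) (by omega) h2
      omega

/-! ### Flows, plane rotations and Euler's inequality -/

section Rotation

variable {V : Type*} {G : SimpleGraph V}

/-- The permutation `d ↦ (σ d).symm`, whose orbits are the facial walks of the rotation `σ`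
(traversed backwards). -/
def facePerm (σ : Equiv.Perm G.Dart) : Equiv.Perm G.Dart :=
  σ.trans (Dart.symm_involutive.toPerm _)

theorem facePerm_apply (σ : Equiv.Perm G.Dart) (d : G.Dart) : facePerm σ d = (σ d).symm := rfl

/-- The faces of a rotation: the orbits of `facePerm`. -/
abbrev Face (σ : Equiv.Perm G.Dart) : Type _ :=
  Quotient (Equiv.Perm.SameCycle.setoid (facePerm σ))

/-- The face to the left of a dart. -/
abbrev face (σ : Equiv.Perm G.Dart) (d : G.Dart) : Face σ :=
  Quotient.mk (Equiv.Perm.SameCycle.setoid (facePerm σ)) d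

theorem face_eq_iff {σ : Equiv.Perm G.Dart} {d e : G.Dart} :
    face σ d = face σ e ↔ (facePerm σ).SameCycle d e := Quotient.eq

theorem eq_of_facePerm_sameCycle [Finite G.Dart] {σ : Equiv.Perm G.Dart}
    {p : G.Dart → ℝ} (hp : ∀ d, p d = p (σ d).symm) {d e : G.Dart}
    (h : (facePerm σ).SameCycle d e) : p d = p e := by
  obtain ⟨n, rfl⟩ := h.exists_nat_pow_eq
  induction n with
  | zero => rfl
  | succ n ih =>
    rw [pow_succ', Equiv.Perm.mul_apply, facePerm_apply, ← hp]
    exact ih ⟨n, by simp⟩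

variable [Fintype V] [DecidableEq V] [DecidableRel G.Adj]

/-- A real flow (circulation) on `G`: an antisymmetric function on the darts whose net outflow
vanishes at every vertex. -/
structure IsFlow (C : G.Dart → ℝ) : Prop where
  symm : ∀ d, C d.symm = -C d
  div : ∀ v, ∑ d with d.fst = v, C d = 0

/-- A rotation of a cubic graph that behaves like the counterclockwise rotation of a plane drawing.
It permutes cyclically the three darts leaving each vertex, and every flow `C` has a potential `p`:
a value on the region to the left of each dart such that turning around a corner does not change
the value and crossing an edge changes it by the flow through that edge. -/
structure IsPlaneRotation (σ : Equiv.Perm G.Dart) : Prop where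
  fst_eq : ∀ d, (σ d).fst = d.fst
  ne : ∀ d, σ d ≠ d
  cube : ∀ d, σ (σ (σ d)) = d
  potential : ∀ C : G.Dart → ℝ, IsFlow C →
    ∃ p : G.Dart → ℝ, ∀ d, p d = p (σ d).symm ∧ p d - p d.symm = C d

/-- The linear map that sends functions on faces, vertices and edges to the function on darts
given by: jump from right to left, minus the increment along the dart, plus the value of the
edge. -/
noncomputable def dartMap (σ : Equiv.Perm G.Dart) :
    ((Face σ → ℝ) × (V → ℝ) × (G.edgeSet → ℝ)) →ₗ[ℝ] (G.Dart → ℝ) where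
  toFun x d := x.1 (face σ d) - x.1 (face σ d.symm) + (x.2.1 d.fst - x.2.1 d.snd) +
    x.2.2 ⟨d.edge, d.edge_mem⟩
  map_add' x y := by ext d; simp; ring
  map_smul' c x := by ext d; simp; ring

/-- A functional vanishing on the image of `dartMap` is given by an antisymmetric function (test
with edges) that is a flow (test with vertices) and hence is orthogonal to itself (test with the
potential). -/
theorem IsPlaneRotation.dartMap_surjective {σ : Equiv.Perm G.Dart} (hσ : IsPlaneRotation σ) :
    Function.Surjective (dartMap σ) := by
  classical
  rw [← LinearMap.range_eq_top]
  by_contra hne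
  obtain ⟨f, hf0, hf⟩ := Submodule.exists_le_ker_of_lt_top _ (lt_top_iff_ne_top.2 hne)
  apply hf0
  set C : G.Dart → ℝ := fun d => f (Pi.single d 1) with hC
  have hfg : ∀ g, f g = ∑ d, g d * C d := fun g => by
    conv_lhs => rw [← Finset.univ_sum_single g, map_sum]
    refine Finset.sum_congr rfl fun d _ => ?_
    rw [hC, ← smul_eq_mul, ← map_smul, ← Pi.single_smul, smul_eq_mul, mul_one]
  have h0 : ∀ x, ∑ d, dartMap σ x d * C d = 0 := fun x => by
    rw [← hfg]; exact hf (LinearMap.mem_range_self _ x)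
  have hanti : ∀ d : G.Dart, C d.symm = -C d := by
    intro d
    have h := h0 (0, 0, Pi.single ⟨d.edge, d.edge_mem⟩ 1)
    have h2 : ∀ e : G.Dart, dartMap σ (0, 0, Pi.single ⟨d.edge, d.edge_mem⟩ 1) e =
        if e ∈ ({d, d.symm} : Finset G.Dart) then 1 else 0 := by
      intro e
      simp [dartMap, Pi.single_apply, Subtype.ext_iff, dart_edge_eq_iff]
    simp only [h2, ite_mul, one_mul, zero_mul, Finset.sum_ite_mem, Finset.univ_inter] at h
    rw [Finset.sum_pair d.symm_ne.symm] at h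
    linarith
  have hsymm_sum : ∀ g : V → ℝ, ∑ d : G.Dart, g d.snd * C d = -∑ d : G.Dart, g d.fst * C d := by
    intro g
    rw [← Finset.sum_neg_distrib]
    refine Fintype.sum_equiv (Dart.symm_involutive.toPerm _) _ _ fun d => ?_
    change g d.snd * C d = -(g d.symm.fst * C d.symm)
    rw [hanti]; simp [Dart.symm]
  have hflow : IsFlow C := by
    refine ⟨hanti, fun v => ?_⟩
    have h := h0 (0, Pi.single v 1, 0)
    simp only [dartMap, LinearMap.coe_mk, AddHom.coe_mk, Pi.zero_apply, sub_self, zero_add,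
      add_zero, sub_mul, Finset.sum_sub_distrib] at h
    rw [hsymm_sum] at h
    rw [Finset.sum_filter]
    have h3 : ∑ d : G.Dart, (Pi.single v 1 : V → ℝ) d.fst * C d =
        ∑ d : G.Dart, if d.fst = v then C d else 0 :=
      Finset.sum_congr rfl fun d _ => by simp [Pi.single_apply]
    rw [h3] at h
    linarith
  obtain ⟨p, hp⟩ := hσ.potential C hflow
  have h := h0 (Quotient.lift p fun _ _ h =>
    eq_of_facePerm_sameCycle (fun d => (hp d).1) h, 0, 0)
  have h4 : ∑ d, C d * C d = 0 := by
    rw [← h]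
    refine Finset.sum_congr rfl fun d _ => ?_
    simp only [dartMap, LinearMap.coe_mk, AddHom.coe_mk, Quotient.lift_mk, (hp d).2]
    simp
  have h5 := (Finset.sum_eq_zero_iff_of_nonneg fun d _ => mul_self_nonneg (C d)).1 h4
  ext d
  simpa using h5 d (Finset.mem_univ _)

open Classical in
/-- Euler's inequality `V - E + F ≥ 1`; the constant functions on the faces make `dartMap`
noninjective. -/
theorem IsPlaneRotation.card_lt {σ : Equiv.Perm G.Dart} (hσ : IsPlaneRotation σ)
    [hne : Nonempty G.Dart] :
    Fintype.card G.Dart < 2 * (Fintype.card (Face σ) + Fintype.card V) := by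
  have hsurj := hσ.dartMap_surjective
  have hE : Fintype.card G.Dart = 2 * Fintype.card G.edgeSet := by
    rw [dart_card_eq_twice_card_edges, edgeFinset_card]
  have hdim : Module.finrank ℝ ((Face σ → ℝ) × (V → ℝ) × (G.edgeSet → ℝ)) =
      Fintype.card (Face σ) + (Fintype.card V + Fintype.card G.edgeSet) := by
    simp [Module.finrank_prod]
  have hdim' : Module.finrank ℝ (G.Dart → ℝ) = Fintype.card G.Dart := by simp
  have hle := LinearMap.finrank_le_finrank_of_surjective (f := dartMap σ) hsurj
  have hneq : Module.finrank ℝ ((Face σ → ℝ) × (V → ℝ) × (G.edgeSet → ℝ)) ≠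
      Module.finrank ℝ (G.Dart → ℝ) := by
    intro heq
    have hinj := (LinearMap.injective_iff_surjective_of_finrank_eq_finrank heq).2 hsurj
    have h := @hinj (fun _ => 1, 0, 0) 0 (by ext d; simp [dartMap])
    obtain ⟨d⟩ := hne
    have := congrFun (congrArg Prod.fst h) (face σ d)
    simp at this
  omega

end Rotation

/-! ### Facial walks are cycles -/

section Faces

variable {V : Type*} {G : SimpleGraph V} {σ : Equiv.Perm G.Dart}

theorem face_iterate (d : G.Dart) (i : ℕ) : face σ ((facePerm σ)^[i] d) = face σ d := by
  rw [face_eq_iff]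
  exact Equiv.Perm.SameCycle.symm ⟨i, by simp [Equiv.Perm.iterate_eq_pow]⟩

theorem face_facePerm (d : G.Dart) : face σ (σ d).symm = face σ d := face_iterate d 1

/-- The length of the facial walk through `d`. -/
noncomputable def faceLength (σ : Equiv.Perm G.Dart) (d : G.Dart) : ℕ :=
  Function.minimalPeriod (facePerm σ) d

theorem facePerm_mem_periodicPts [Finite G.Dart] (d : G.Dart) :
    d ∈ Function.periodicPts (facePerm σ) :=
  (facePerm σ).injective.mem_periodicPts d

theorem faceLength_pos [Finite G.Dart] (d : G.Dart) : 0 < faceLength σ d :=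
  Function.minimalPeriod_pos_of_mem_periodicPts (facePerm_mem_periodicPts d)

theorem four_mem_cycleSpectrum {a b c d : V} (hab : G.Adj a b) (hbc : G.Adj b c)
    (hcd : G.Adj c d) (hda : G.Adj d a) (hac : a ≠ c) (hbd : b ≠ d) : 4 ∈ cycleSpectrum G := by
  refine ⟨a, Walk.cons hab (Walk.cons hbc (Walk.cons hcd (Walk.cons hda Walk.nil))), ?_, rfl⟩
  rw [Walk.cons_isCycle_iff]
  simp [hab.ne, hab.ne', hbc.ne, hcd.ne, hda.ne, hda.ne', hac, hac.symm, hbd]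

variable [DecidableEq V]

/-- The unit flow along a dart. -/
def dartFlow (d e : G.Dart) : ℝ :=
  (if e = d then 1 else 0) - if e = d.symm then 1 else 0

theorem dartFlow_symm (d e : G.Dart) : dartFlow d e.symm = -dartFlow d e := by
  have h1 : e.symm = d ↔ e = d.symm := by
    constructor <;> rintro rfl <;> simp
  have h2 : e.symm = d.symm ↔ e = d := Dart.symm_involutive.injective.eq_iff
  simp [dartFlow, h1, h2]

variable [Fintype V] [DecidableRel G.Adj]

open Classical in
theorem filter_face_eq (d : G.Dart) : (Finset.univ.filter fun e => face σ e = face σ d) =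
    (Finset.range (faceLength σ d)).image fun i => (facePerm σ)^[i] d := by
  ext e
  simp only [Finset.mem_filter, Finset.mem_univ, true_and, Finset.mem_image, Finset.mem_range]
  constructor
  · intro h
    obtain ⟨n, rfl⟩ := (face_eq_iff.1 h.symm).exists_nat_pow_eq
    refine ⟨n % faceLength σ d, Nat.mod_lt _ (faceLength_pos d), ?_⟩
    rw [← Equiv.Perm.iterate_eq_pow]
    exact Function.iterate_mod_minimalPeriod_eq
  · rintro ⟨i, -, rfl⟩
    exact face_iterate d i

open Classical in
theorem card_filter_face_eq (d : G.Dart) :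
    (Finset.univ.filter fun e => face σ e = face σ d).card = faceLength σ d := by
  rw [filter_face_eq, Finset.card_image_of_injOn, Finset.card_range]
  intro i hi j hj h
  exact Function.iterate_injOn_Iio_minimalPeriod (by simpa [faceLength] using hi)
    (by simpa [faceLength] using hj) h

theorem faceLength_congr {d e : G.Dart} (h : face σ d = face σ e) :
    faceLength σ d = faceLength σ e := by
  classical
  rw [← card_filter_face_eq, ← card_filter_face_eq, h]

theorem IsPlaneRotation.ne_sq (hσ : IsPlaneRotation σ) (d : G.Dart) : σ (σ d) ≠ d := fun h =>
  hσ.ne d <| by simpa [h] using hσ.cube d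

theorem IsPlaneRotation.eq_or_of_fst_eq (hσ : IsPlaneRotation σ) (hreg : G.IsRegularOfDegree 3)
    {d e : G.Dart} (h : e.fst = d.fst) : e = d ∨ e = σ d ∨ e = σ (σ d) := by
  have hcard : (Finset.univ.filter fun e : G.Dart => e.fst = d.fst).card = 3 := by
    rw [dart_fst_fiber_card_eq_degree, hreg]
  have hsub : ({d, σ d, σ (σ d)} : Finset G.Dart) ⊆
      Finset.univ.filter fun e : G.Dart => e.fst = d.fst := by
    intro x hx
    simp only [Finset.mem_insert, Finset.mem_singleton] at hx
    rcases hx with rfl | rfl | rfl <;> simp [hσ.fst_eq]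
  have h3 : ({d, σ d, σ (σ d)} : Finset G.Dart).card = 3 :=
    Finset.card_eq_three.2 ⟨_, _, _, (hσ.ne d).symm, (hσ.ne_sq d).symm, (hσ.ne (σ d)).symm, rfl⟩
  have heq := Finset.eq_of_subset_of_card_le hsub (by rw [hcard, h3])
  have : e ∈ ({d, σ d, σ (σ d)} : Finset G.Dart) := by rw [heq]; simp [h]
  simpa using this

theorem IsPlaneRotation.face_ne_face_symm (hσ : IsPlaneRotation σ) {d : G.Dart}
    (hd : ∃ C, IsFlow C ∧ C d ≠ 0) : face σ d ≠ face σ d.symm := by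
  obtain ⟨C, hC, hd⟩ := hd
  obtain ⟨p, hp⟩ := hσ.potential C hC
  intro h
  have := eq_of_facePerm_sameCycle (fun d => (hp d).1) (face_eq_iff.1 h)
  exact hd (by rw [← (hp d).2, this, sub_self])

/-- If the two sides of every edge belong to different faces, then facial walks are cycles: a
facial walk in a cubic graph that visits a vertex twice traverses an edge in both directions. -/
theorem IsPlaneRotation.faceLength_mem (hσ : IsPlaneRotation σ) (hreg : G.IsRegularOfDegree 3)
    (hface : ∀ d, face σ d ≠ face σ d.symm) (d : G.Dart) :
    faceLength σ d ∈ cycleSpectrum G := by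
  set φ := facePerm σ with hφ
  have hadj : ∀ e : G.Dart, G.Adj e.fst (φ e).fst := fun e => by
    have := (σ e).adj
    rw [hσ.fst_eq] at this
    exact this
  have hper : φ^[faceLength σ d] d = d := Function.iterate_minimalPeriod
  refine mem_cycleSpectrum_of_sequence (fun i => (φ^[i] d).fst) ?_ ?_ ?_ ?_
  · have h0 := faceLength_pos (σ := σ) d
    by_contra hlt
    have h12 : faceLength σ d = 1 ∨ faceLength σ d = 2 := by omega
    rcases h12 with h1 | h2
    · rw [h1] at hper
      have := hadj d
      rw [show φ d = d from hper] at this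
      exact this.ne rfl
    · rw [h2] at hper
      have hper' : (σ (σ d).symm).symm = d := hper
      apply hface d
      rw [← face_facePerm d]
      congr 1
      have h1 : (σ d).fst = d.fst := hσ.fst_eq d
      have h3 : (σ d).symm.fst = d.snd := by
        rw [← hσ.fst_eq (σ d).symm]
        conv_rhs => rw [← hper']
        rfl
      exact Dart.ext _ _ (Prod.ext h3 h1)
  · intro i _
    simp only [Function.iterate_succ_apply']
    exact hadj _
  · simp only [hper, Function.iterate_zero, id]
  · intro i hi j hj h
    have hfi : face σ (φ^[i] d) = face σ (φ^[j] d) := by rw [face_iterate, face_iterate]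
    rcases hσ.eq_or_of_fst_eq hreg h with h | h | h
    · exact Function.iterate_injOn_Iio_minimalPeriod hi hj h
    · exfalso
      apply hface (φ^[i] d)
      rw [hfi, ← face_facePerm, ← h]
    · exfalso
      apply hface (φ^[j] d)
      rw [← hfi, ← face_facePerm, h, hσ.cube]

/-! ### Short cycles from Euler's inequality -/

open Classical in
/-- In a cubic graph there is no assignment of the darts to the faces for which every face
receives at least six darts. -/
theorem IsPlaneRotation.exists_card_fiber_lt_six (hσ : IsPlaneRotation σ)
    (hreg : G.IsRegularOfDegree 3) [Nonempty G.Dart] (κ : G.Dart → Face σ) :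
    ∃ d, (Finset.univ.filter fun e => κ e = face σ d).card < 6 := by
  by_contra! hno
  have hD : Fintype.card G.Dart = Fintype.card V * 3 := by
    rw [dart_card_eq_sum_degrees]
    simp [hreg.degree_eq]
  have h6 : Fintype.card (Face σ) * 6 ≤ Fintype.card G.Dart := by
    rw [← Finset.card_univ (α := G.Dart), ← Finset.card_univ (α := Face σ),
      Finset.card_eq_sum_card_fiberwise (f := κ) (t := Finset.univ) (by simp), ← smul_eq_mul]
    refine Finset.card_nsmul_le_sum _ _ _ fun q _ => ?_
    induction q using Quotient.inductionOn with
    | h d => exact hno d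
  have := hσ.card_lt
  omega

theorem IsPlaneRotation.exists_mem_cycleSpectrum_le_five (hσ : IsPlaneRotation σ)
    (hreg : G.IsRegularOfDegree 3) (hface : ∀ d, face σ d ≠ face σ d.symm) [Nonempty G.Dart] :
    ∃ n ∈ cycleSpectrum G, n ≤ 5 := by
  classical
  obtain ⟨d, hd⟩ := hσ.exists_card_fiber_lt_six hreg (face σ)
  rw [card_filter_face_eq] at hd
  exact ⟨_, hσ.faceLength_mem hreg hface d, by omega⟩

theorem IsPlaneRotation.exists_of_faceLength_eq_three (hσ : IsPlaneRotation σ) {d : G.Dart}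
    (h : faceLength σ d = 3) : ∃ (w : V) (h1 : G.Adj d.fst w) (h2 : G.Adj d.snd w),
      σ d = ⟨(d.fst, w), h1⟩ ∧ σ ⟨(d.snd, w), h2⟩ = d.symm := by
  have hper : (facePerm σ)^[faceLength σ d] d = d := Function.iterate_minimalPeriod
  rw [h] at hper
  have hper' : (σ (σ (σ d).symm).symm).symm = d := hper
  have hf : (σ d).fst = d.fst := hσ.fst_eq d
  have hf' : (σ (σ d).symm).fst = (σ d).snd := hσ.fst_eq _
  have hf'' : (σ (σ d).symm).snd = d.snd := by
    have := hσ.fst_eq (σ (σ d).symm).symm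
    rw [← congrArg (fun e : G.Dart => e.snd) hper']
    exact this.symm
  have hyz : G.Adj d.snd (σ d).snd := by
    have := (σ (σ d).symm).adj
    rw [hf', hf''] at this
    exact this.symm
  have e1 : σ d = ⟨(d.fst, (σ d).snd), hf ▸ (σ d).adj⟩ := Dart.ext _ _ (Prod.ext hf rfl)
  have e2 : (σ (σ d).symm).symm = ⟨(d.snd, (σ d).snd), hyz⟩ :=
    Dart.ext _ _ (Prod.ext hf'' hf')
  refine ⟨(σ d).snd, _, hyz, e1, ?_⟩
  rw [← e2]
  conv_rhs => rw [← hper', Dart.symm_symm]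

/-- Without `4`-cycles, no edge has a triangular face on both sides. -/
theorem IsPlaneRotation.faceLength_symm_ne_three (hσ : IsPlaneRotation σ)
    (h4 : 4 ∉ cycleSpectrum G) {d : G.Dart} (h : faceLength σ d = 3) :
    faceLength σ d.symm ≠ 3 := by
  intro h'
  obtain ⟨z, hxz, hyz, h1, -⟩ := hσ.exists_of_faceLength_eq_three h
  obtain ⟨w, hyw, hxw, -, h2⟩ := hσ.exists_of_faceLength_eq_three h'
  by_cases hzw : z = w
  · subst hzw
    apply hσ.ne_sq d
    rw [h1]
    exact h2
  · exact h4 (four_mem_cycleSpectrum hxz hyz.symm hyw hxw.symm d.adj.ne hzw)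

/-- Without `4`-cycles, a facial walk never runs along triangular faces on two consecutive
edges. -/
theorem IsPlaneRotation.faceLength_facePerm_symm_ne_three (hσ : IsPlaneRotation σ)
    (h4 : 4 ∉ cycleSpectrum G) {d : G.Dart} (h : faceLength σ d.symm = 3) :
    faceLength σ (facePerm σ d).symm ≠ 3 := by
  intro h'
  rw [facePerm_apply, Dart.symm_symm] at h'
  obtain ⟨w, hcw, hbw, -, h2⟩ := hσ.exists_of_faceLength_eq_three h
  obtain ⟨u, hbu, hau, h1, -⟩ := hσ.exists_of_faceLength_eq_three h'
  have hb : (σ d).fst = d.fst := hσ.fst_eq d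
  have hcyc := hσ.cube d
  rw [h1] at hcyc
  have huw : u = w := by
    have := σ.injective (hcyc.trans (Dart.symm_symm d).symm |>.trans h2.symm)
    exact congrArg (fun e : G.Dart => e.snd) this
  subst huw
  refine h4 (four_mem_cycleSpectrum (a := (σ d).snd) (b := d.fst) (c := d.snd) (d := u)
    (hb ▸ (σ d).adj.symm) d.adj hcw hau.symm ?_ hbw.ne)
  intro hac
  exact hσ.ne d (Dart.ext _ _ (Prod.ext hb hac))

/-- Each dart is assigned to the face on its left, except that darts with a triangular face on
their right are assigned to that face. Without cycles of lengths `4, …, 10`, triangular faces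
then receive `3 + 3` darts, and every longer face keeps at least half of its at least `11`
darts. -/
theorem IsPlaneRotation.exists_mem_cycleSpectrum_Icc (hσ : IsPlaneRotation σ)
    (hreg : G.IsRegularOfDegree 3) (hface : ∀ d, face σ d ≠ face σ d.symm) [Nonempty G.Dart] :
    ∃ n ∈ cycleSpectrum G, 4 ≤ n ∧ n ≤ 10 := by
  classical
  by_contra! hno
  have h4 : 4 ∉ cycleSpectrum G := fun h => by have := hno 4 h le_rfl; omega
  obtain ⟨d, hd⟩ := hσ.exists_card_fiber_lt_six hreg fun e =>
    if faceLength σ e.symm = 3 then face σ e.symm else face σ e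
  apply hd.not_ge
  set O := Finset.univ.filter fun e => face σ e = face σ d with hO
  have hOcard : O.card = faceLength σ d := card_filter_face_eq d
  have hmem : ∀ e, e ∈ O ↔ face σ e = face σ d := by simp [hO]
  by_cases h3 : faceLength σ d = 3
  · have hinj : Function.Injective (Dart.symm : G.Dart → G.Dart) := Dart.symm_involutive.injective
    have hdisj : Disjoint O (O.image Dart.symm) := by
      rw [Finset.disjoint_left]
      intro e he he'
      obtain ⟨e', h1, rfl⟩ := Finset.mem_image.1 he'
      exact hface e' (((hmem _).1 h1).trans ((hmem _).1 he).symm)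
    have hc : (O ∪ O.image Dart.symm).card = 6 := by
      rw [Finset.card_union_of_disjoint hdisj, Finset.card_image_of_injective _ hinj, hOcard, h3]
    rw [← hc]
    refine Finset.card_le_card fun e he => ?_
    rw [Finset.mem_filter]
    refine ⟨Finset.mem_univ _, ?_⟩
    rcases Finset.mem_union.1 he with he | he
    · rw [hmem] at he
      rw [if_neg (hσ.faceLength_symm_ne_three h4 ((faceLength_congr he).trans h3)), he]
    · obtain ⟨e', h1, rfl⟩ := Finset.mem_image.1 he
      rw [hmem] at h1
      rw [Dart.symm_symm, if_pos ((faceLength_congr h1).trans h3), h1]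
  · have h11 : 11 ≤ O.card := by
      rw [hOcard]
      have hm := hσ.faceLength_mem hreg hface d
      have h3' : 3 ≤ faceLength σ d := by
        obtain ⟨v, c, hc, hl⟩ := hm
        rw [← hl]
        exact hc.three_le_length
      by_contra hlt
      have := hno _ hm (by omega)
      omega
    have hsum := Finset.card_filter_add_card_filter_not (s := O)
      (fun e => faceLength σ e.symm = 3)
    have hle : (O.filter fun e => faceLength σ e.symm = 3).card ≤
        (O.filter fun e => ¬ faceLength σ e.symm = 3).card := by
      refine Finset.card_le_card_of_injOn (facePerm σ) ?_ (facePerm σ).injective.injOn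
      intro e he
      simp only [Finset.coe_filter, Set.mem_ofPred_eq, hmem] at he ⊢
      exact ⟨(face_facePerm e).trans he.1, hσ.faceLength_facePerm_symm_ne_three h4 he.2⟩
    have hle' : (O.filter fun e => ¬ faceLength σ e.symm = 3).card ≤ _ := Finset.card_le_card
      (t := Finset.univ.filter fun e =>
        (if faceLength σ e.symm = 3 then face σ e.symm else face σ e) = face σ d) (by
        intro e he
        simp only [Finset.mem_filter, hmem, Finset.mem_univ, true_and] at he ⊢
        rw [if_neg he.2, he.1])
    omega

/-! ### Flows in 2-connected graphs -/

theorem sum_dartFlow (d : G.Dart) (v : V) : ∑ e with e.fst = v, dartFlow d e =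
    (if v = d.fst then 1 else 0) - if v = d.snd then 1 else 0 := by
  simp only [dartFlow, Finset.sum_sub_distrib, Finset.sum_ite_eq', Finset.mem_filter,
    Finset.mem_univ, true_and, eq_comm (a := v)]
  rfl

/-- A 2-connected cubic graph has a flow through each edge `u v`: a path from `v` to another
neighbour of `u` that avoids `u` is completed to a closed walk. -/
theorem exists_isFlow_ne_zero (hconn : IsKConnected 2 G) (hreg : G.IsRegularOfDegree 3)
    (d : G.Dart) : ∃ C, IsFlow C ∧ C d ≠ 0 := by
  obtain ⟨w, hw, hwv⟩ : ∃ w, G.Adj d.fst w ∧ w ≠ d.snd := by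
    have hcard : 1 < (G.neighborFinset d.fst).card := by
      rw [card_neighborFinset_eq_degree, hreg]; norm_num
    obtain ⟨w, hw, hne⟩ := Finset.exists_mem_ne hcard d.snd
    exact ⟨w, by simpa using hw, hne⟩
  have hc := hconn.2 {d.fst} (by simp)
  have hpath : ∀ a b : ((({d.fst} : Finset V) : Set V)ᶜ : Set V),
      (G.induce ((({d.fst} : Finset V) : Set V)ᶜ)).Walk a b →
      ∃ C : G.Dart → ℝ, (∀ e, C e.symm = -C e) ∧ (∀ e, e.fst = d.fst → C e = 0) ∧
        ∀ v, ∑ e with e.fst = v, C e =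
          (if v = (a : V) then 1 else 0) - if v = (b : V) then 1 else 0 := by
    intro a b p
    induction p with
    | nil => exact ⟨0, by simp⟩
    | @cons a c b h p ih =>
      obtain ⟨C, h1, h2, h3⟩ := ih
      have hac : G.Adj a c := h
      have ha : (a : V) ≠ d.fst := by simpa using a.2
      have hc : (c : V) ≠ d.fst := by simpa using c.2
      refine ⟨fun e => dartFlow (⟨(a, c), hac⟩ : G.Dart) e + C e, fun e => ?_, fun e he => ?_,
        fun v => ?_⟩
      · simp only [dartFlow_symm, h1]; ring
      · simp only []
        rw [h2 e he, add_zero, dartFlow, if_neg, if_neg, sub_zero]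
        · rintro rfl; exact hc he
        · rintro rfl; exact ha he
      · rw [Finset.sum_add_distrib, sum_dartFlow, h3]; ring
  obtain ⟨p⟩ := hc.preconnected ⟨d.snd, by simp⟩ ⟨w, by simpa using hw.ne'⟩
  obtain ⟨C, h1, h2, h3⟩ := hpath _ _ p
  refine ⟨fun e => C e + dartFlow d e + dartFlow (⟨(w, d.fst), hw.symm⟩ : G.Dart) e,
    ⟨fun e => ?_, fun v => ?_⟩, ?_⟩
  · simp only [dartFlow_symm, h1]; ring
  · rw [Finset.sum_add_distrib, Finset.sum_add_distrib, sum_dartFlow, sum_dartFlow, h3]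
    ring
  · have hne1 : d ≠ ⟨(w, d.fst), hw.symm⟩ := fun h => hw.ne (congrArg (fun e : G.Dart => e.fst) h)
    have hne2 : d ≠ (⟨(w, d.fst), hw.symm⟩ : G.Dart).symm := fun h =>
      hwv (congrArg (fun e : G.Dart => e.snd) h).symm
    simp only [h2 d rfl, dartFlow, d.symm_ne.symm, hne1, hne2]
    norm_num

end Faces

/-! ### The angle under which a segment is seen -/

section Angle

open Complex Filter Topology

/-- The argument in `(-π, π)`, set to `0` (the mean of its two one-sided limits) on the negative
real axis. This makes it odd under inversion. -/
noncomputable def sarg (z : ℂ) : ℝ := if z.arg = Real.pi then 0 else z.arg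

theorem sarg_inv (z : ℂ) : sarg z⁻¹ = -sarg z := by
  unfold sarg
  rw [arg_inv]
  by_cases h : z.arg = Real.pi
  · simp [h]
  · have h2 : -z.arg ≠ Real.pi := by have := neg_pi_lt_arg z; intro h'; linarith
    simp [h, h2]

theorem sarg_real_mul (z : ℂ) {r : ℝ} (hr : 0 < r) : sarg (r * z) = sarg z := by
  unfold sarg
  rw [arg_real_mul z hr]

theorem sarg_eq_arg {z : ℂ} (hz : z ∈ slitPlane) : sarg z = z.arg :=
  if_neg (mem_slitPlane_iff_arg.1 hz).1

theorem sarg_ofReal_neg {r : ℝ} (hr : r < 0) : sarg r = 0 :=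
  if_pos (arg_ofReal_of_neg hr)

theorem sarg_neg_one : sarg (-1) = 0 := by
  simpa using sarg_ofReal_neg (r := -1) (by norm_num)

theorem sarg_eventuallyEq {z : ℂ} (hz : z ∈ slitPlane) : sarg =ᶠ[𝓝 z] arg := by
  filter_upwards [isOpen_slitPlane.mem_nhds hz] with w hw using sarg_eq_arg hw

theorem continuousAt_sarg {z : ℂ} (hz : z ∈ slitPlane) : ContinuousAt sarg z :=
  (continuousAt_arg hz).congr (sarg_eventuallyEq hz).symm

theorem notMem_slitPlane {z : ℂ} (hz : z ∉ slitPlane) : ∃ r : ℝ, 0 ≤ r ∧ z = -r := by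
  rw [mem_slitPlane_iff_not_le_zero, not_not, Complex.le_def] at hz
  refine ⟨-z.re, by simpa using hz.1, ?_⟩
  apply Complex.ext <;> simp [hz.2]

/-- The oriented angle under which the segment from `p` to `q` is seen from `x`. -/
noncomputable def viewAngle (p q x : ℂ) : ℝ := sarg ((q - x) / (p - x))

theorem viewAngle_swap (p q x : ℂ) : viewAngle q p x = -viewAngle p q x := by
  rw [viewAngle, viewAngle, ← sarg_inv, inv_div]

theorem div_mem_slitPlane {p q x : ℂ} (h : x ∉ segment ℝ p q) :
    (q - x) / (p - x) ∈ slitPlane := by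
  by_contra hz
  obtain ⟨r, hr, he⟩ := notMem_slitPlane hz
  have hp : p - x ≠ 0 := fun h0 => h (sub_eq_zero.1 h0 ▸ left_mem_segment ℝ p q)
  rw [div_eq_iff hp] at he
  apply h
  refine ⟨r / (1 + r), 1 / (1 + r), by positivity, by positivity, by field_simp; ring, ?_⟩
  have h1 : (1 + r : ℂ) ≠ 0 := by exact_mod_cast (by positivity : (1 + r : ℝ) ≠ 0)
  simp only [real_smul]
  push_cast
  field_simp
  linear_combination he

/-- The limit of `viewAngle p q (w + s * a)` as `s → 0⁺`, for segments that do not pass through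
`w` in the direction `a`. -/
noncomputable def dirAngle (p q w a : ℂ) : ℝ :=
  if p = w then sarg (-(q - w) / a) else if q = w then -sarg (-(p - w) / a)
  else sarg ((q - w) / (p - w))

theorem dirAngle_swap {p q : ℂ} (hpq : p ≠ q) (w a : ℂ) : dirAngle q p w a = -dirAngle p q w a := by
  unfold dirAngle
  by_cases h1 : p = w
  · subst h1; simp [hpq.symm]
  · by_cases h2 : q = w
    · simp [h1, h2]
    · simp only [h1, h2, if_false]
      rw [← sarg_inv, inv_div]

theorem dirAngle_congr {p q w : ℂ} (hp : p ≠ w) (hq : q ≠ w) (a b : ℂ) :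
    dirAngle p q w a = dirAngle p q w b := by
  simp [dirAngle, hp, hq]

/-- Two segments are equal up to orientation, or meet at most in common end points. -/
def NonCrossing (p q w w' : ℂ) : Prop :=
  (p = w ∧ q = w') ∨ (p = w' ∧ q = w) ∨ segment ℝ p q ∩ segment ℝ w w' ⊆ {p, q} ∩ {w, w'}

theorem NonCrossing.swap_right {p q w w' : ℂ} (h : NonCrossing p q w w') :
    NonCrossing p q w' w := by
  rcases h with h | h | h
  · exact Or.inr (Or.inl ⟨h.1, h.2⟩)
  · exact Or.inl ⟨h.1, h.2⟩
  · exact Or.inr (Or.inr (by rwa [segment_symm ℝ w', Set.pair_comm w']))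

theorem add_mul_mem_segment {w a : ℂ} {t : ℝ} (h0 : 0 ≤ t) (h1 : t ≤ 1) :
    w + t * a ∈ segment ℝ w (w + a) := by
  rw [segment_eq_image']
  exact ⟨t, ⟨h0, h1⟩, by simp⟩

/-- Two segments that meet only in their common initial point have different directions. -/
theorem neg_div_mem_slitPlane {w q w' : ℂ} (hq : q ≠ w) (hw : w' ≠ w)
    (h : segment ℝ w q ∩ segment ℝ w w' ⊆ {w, w'}) : -(q - w) / (w' - w) ∈ slitPlane := by
  have ha : w' - w ≠ 0 := sub_ne_zero.2 hw
  by_contra hz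
  obtain ⟨r, hr, he⟩ := notMem_slitPlane hz
  have hqr : q = w + r * (w' - w) := by
    rw [div_eq_iff ha] at he
    linear_combination -he
  have hr0 : 0 < r := by
    refine lt_of_le_of_ne hr ?_
    rintro rfl
    exact hq (by simpa using hqr)
  set s : ℝ := min r 1 / 2 with hs
  have hs0 : 0 < s := by positivity
  have hs1 : s < 1 := by have := min_le_right r 1; linarith
  have hsr : s ≤ r := by have := min_le_left r 1; linarith
  have hmem : w + s * (w' - w) ∈ ({w, w'} : Set ℂ) := by
    apply h
    constructor
    · have := add_mul_mem_segment (w := w) (a := r * (w' - w)) (t := s / r) (by positivity)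
        ((div_le_one hr0).2 hsr)
      rw [← hqr] at this
      convert this using 2
      have : (r : ℂ) ≠ 0 := by exact_mod_cast hr0.ne'
      push_cast
      field_simp
    · simpa using add_mul_mem_segment (w := w) (a := w' - w) hs0.le hs1.le
  rcases hmem with h1 | h1
  · have : (s : ℂ) * (w' - w) = 0 := by linear_combination h1
    rcases mul_eq_zero.1 this with h2 | h2
    · exact hs0.ne' (by exact_mod_cast h2)
    · exact ha h2
  · have : ((s : ℂ) - 1) * (w' - w) = 0 := by
      have h1' : w + s * (w' - w) = w' := h1
      linear_combination h1'
    rcases mul_eq_zero.1 this with h2 | h2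
    · exact hs1.ne (by exact_mod_cast sub_eq_zero.1 h2)
    · exact ha h2

theorem viewAngle_self {w w' : ℂ} (hw : w ≠ w') {t : ℝ} (h0 : 0 < t) (h1 : t < 1) :
    viewAngle w w' (w + t * (w' - w)) = 0 := by
  have ha : w' - w ≠ 0 := sub_ne_zero.2 hw.symm
  have : (w' - (w + t * (w' - w))) / (w - (w + t * (w' - w))) = ((-((1 - t) / t) : ℝ) : ℂ) := by
    have ht : (t : ℂ) ≠ 0 := by exact_mod_cast h0.ne'
    push_cast
    rw [div_eq_iff (by simpa using ⟨h0.ne', ha⟩)]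
    field_simp
    ring
  rw [viewAngle, this]
  apply sarg_ofReal_neg
  have : 0 < (1 - t) / t := div_pos (by linarith) h0
  linarith

/-- The convergence of the viewing angle of a segment that starts at `w`. -/
theorem tendsto_viewAngle_of_slitPlane {w q a : ℂ} (ha : a ≠ 0)
    (h : -(q - w) / a ∈ slitPlane) :
    Tendsto (fun s : ℝ => viewAngle w q (w + s * a)) (𝓝[>] 0) (𝓝 (sarg (-(q - w) / a))) := by
  have h1 : Tendsto (fun s : ℝ => sarg (-(q - w - s * a) / a)) (𝓝[>] 0)
      (𝓝 (sarg (-(q - w) / a))) := by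
    have hc : ContinuousAt (fun s : ℝ => -(q - w - s * a) / a) 0 := by fun_prop
    have h' : -(q - w - ((0 : ℝ) : ℂ) * a) / a ∈ slitPlane := by simpa using h
    have := (ContinuousAt.comp (f := fun s : ℝ => -(q - w - s * a) / a) (continuousAt_sarg h') hc)
    have h2 := this.tendsto.mono_left (nhdsWithin_le_nhds (s := Set.Ioi 0))
    simpa [Function.comp_def] using h2
  refine h1.congr' ?_
  filter_upwards [self_mem_nhdsWithin] with s hs
  have hs' : (s : ℂ) ≠ 0 := by exact_mod_cast (ne_of_gt hs)
  rw [viewAngle, ← sarg_real_mul _ (inv_pos.2 hs)]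
  congr 1
  push_cast
  have : w - (w + s * a) = -(s * a) := by ring
  rw [this]
  field_simp
  ring

theorem tendsto_viewAngle {p q w w' : ℂ} (hpq : p ≠ q) (hw : w ≠ w')
    (h : NonCrossing p q w w') :
    Tendsto (fun s : ℝ => viewAngle p q (w + s * (w' - w))) (𝓝[>] 0)
      (𝓝 (dirAngle p q w (w' - w))) := by
  have ha : w' - w ≠ 0 := sub_ne_zero.2 hw.symm
  have hself : Tendsto (fun s : ℝ => viewAngle w w' (w + s * (w' - w))) (𝓝[>] 0)
      (𝓝 (dirAngle w w' w (w' - w))) := by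
    have h0 : dirAngle w w' w (w' - w) = 0 := by
      rw [dirAngle, if_pos rfl, neg_div, div_self ha, sarg_neg_one]
    rw [h0]
    refine tendsto_const_nhds.congr' ?_
    filter_upwards [Ioo_mem_nhdsGT (zero_lt_one' ℝ)] with s hs
    rw [viewAngle_self hw hs.1 hs.2]
  have hstart : ∀ q, q ≠ w → segment ℝ w q ∩ segment ℝ w w' ⊆ {w, w'} →
      Tendsto (fun s : ℝ => viewAngle w q (w + s * (w' - w))) (𝓝[>] 0)
      (𝓝 (dirAngle w q w (w' - w))) := by
    intro q hq hsub
    rw [dirAngle, if_pos rfl]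
    exact tendsto_viewAngle_of_slitPlane ha (neg_div_mem_slitPlane hq hw.symm hsub)
  rcases h with ⟨rfl, rfl⟩ | ⟨rfl, rfl⟩ | h
  · exact hself
  · simp only [viewAngle_swap q p, dirAngle_swap hpq.symm]
    exact hself.neg
  · by_cases hp : p = w
    · subst hp
      exact hstart q hpq.symm (h.trans Set.inter_subset_right)
    · by_cases hq : q = w
      · subst hq
        simp only [viewAngle_swap q p, dirAngle_swap hpq.symm]
        refine (hstart p hpq ?_).neg
        rw [segment_symm]
        exact h.trans Set.inter_subset_right
      · have hwn : w ∉ segment ℝ p q := fun hm => by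
          rcases (h ⟨hm, left_mem_segment ℝ w w'⟩).1 with h1 | h1
          · exact hp h1.symm
          · exact hq h1.symm
        have hpw : p - w ≠ 0 := sub_ne_zero.2 hp
        have hc : ContinuousAt (fun s : ℝ => (q - (w + s * (w' - w))) / (p - (w + s * (w' - w))))
            0 := by
          refine ContinuousAt.div (by fun_prop) (by fun_prop) (by simpa using hpw)
        have hslit := div_mem_slitPlane hwn
        have h' : (q - (w + ((0 : ℝ) : ℂ) * (w' - w))) / (p - (w + ((0 : ℝ) : ℂ) * (w' - w))) ∈
            slitPlane := by simpa using hslit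
        have := (ContinuousAt.comp
          (f := fun s : ℝ => (q - (w + s * (w' - w))) / (p - (w + s * (w' - w))))
          (continuousAt_sarg h') hc).tendsto.mono_left (nhdsWithin_le_nhds (s := Set.Ioi 0))
        rw [dirAngle, if_neg hp, if_neg hq]
        simpa [Function.comp_def, viewAngle] using this

/-- The derivative of the viewing angle while the viewer moves along a noncrossing segment is the
difference of two terms that depend on the two end points of the viewed segment only. -/
theorem hasDerivAt_viewAngle {p q w w' : ℂ} (hw : w ≠ w')
    (h : NonCrossing p q w w') {t : ℝ} (h0 : 0 < t) (h1 : t < 1) :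
    HasDerivAt (fun s : ℝ => viewAngle p q (w + s * (w' - w)))
      (((w' - w) / (p - (w + t * (w' - w))) - (w' - w) / (q - (w + t * (w' - w)))).im) t := by
  have ha : w' - w ≠ 0 := sub_ne_zero.2 hw.symm
  have hself : HasDerivAt (fun s : ℝ => viewAngle w w' (w + s * (w' - w)))
      (((w' - w) / (w - (w + t * (w' - w))) - (w' - w) / (w' - (w + t * (w' - w)))).im) t := by
    have ht : (t : ℂ) ≠ 0 := by exact_mod_cast h0.ne'
    have ht1 : (1 - t : ℂ) ≠ 0 := by exact_mod_cast (sub_pos.2 h1).ne'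
    have hval : (w' - w) / (w - (w + t * (w' - w))) - (w' - w) / (w' - (w + t * (w' - w))) =
        ((-1 / t - 1 / (1 - t) : ℝ) : ℂ) := by
      have e1 : w - (w + t * (w' - w)) = -t * (w' - w) := by ring
      have e2 : w' - (w + t * (w' - w)) = (1 - t) * (w' - w) := by ring
      rw [e1, e2]
      push_cast
      field_simp
    rw [hval, ofReal_im]
    refine (hasDerivAt_const t (0 : ℝ)).congr_of_eventuallyEq ?_
    filter_upwards [Ioo_mem_nhds h0 h1] with s hs
    exact viewAngle_self hw hs.1 hs.2
  rcases h with ⟨rfl, rfl⟩ | ⟨rfl, rfl⟩ | h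
  · exact hself
  · simp only [viewAngle_swap q p]
    refine hself.neg.congr_deriv ?_
    rw [← neg_im, neg_sub]
  · have hx : w + t * (w' - w) ∉ segment ℝ p q := by
      intro hm
      have h2 : w + t * (w' - w) ∈ segment ℝ w w' := by
        simpa using add_mul_mem_segment (w := w) (a := w' - w) h0.le h1.le
      rcases (h ⟨hm, h2⟩).2 with h3 | h3
      · have : (t : ℂ) * (w' - w) = 0 := by linear_combination h3
        rcases mul_eq_zero.1 this with h4 | h4
        · exact h0.ne' (by exact_mod_cast h4)
        · exact ha h4
      · have : ((t : ℂ) - 1) * (w' - w) = 0 := by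
          have h3' : w + t * (w' - w) = w' := h3
          linear_combination h3'
        rcases mul_eq_zero.1 this with h4 | h4
        · exact h1.ne (by exact_mod_cast sub_eq_zero.1 h4)
        · exact ha h4
    have hp : p - (w + t * (w' - w)) ≠ 0 := fun h0 =>
      hx (sub_eq_zero.1 h0 ▸ left_mem_segment ℝ p q)
    have hq : q - (w + t * (w' - w)) ≠ 0 := fun h0 =>
      hx (sub_eq_zero.1 h0 ▸ right_mem_segment ℝ p q)
    have hslit := div_mem_slitPlane hx
    have hlin : HasDerivAt (fun s : ℝ => w + s * (w' - w)) (w' - w) t := by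
      simpa using ((hasDerivAt_id t).ofReal_comp.mul_const (w' - w)).const_add w
    have hz := ((hlin.const_sub q).div (hlin.const_sub p) hp).clog_real hslit
    have him := imCLM.hasFDerivAt.comp_hasDerivAt t hz
    have heq : (fun s : ℝ => viewAngle p q (w + s * (w' - w))) =ᶠ[𝓝 t] fun s : ℝ =>
        imCLM (log ((q - (w + s * (w' - w))) / (p - (w + s * (w' - w))))) := by
      have hc : ContinuousAt (fun s : ℝ => (q - (w + s * (w' - w))) / (p - (w + s * (w' - w))))
          t := ((hlin.const_sub q).div (hlin.const_sub p) hp).continuousAt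
      filter_upwards [hc.eventually (sarg_eventuallyEq hslit)] with s hs
      rw [viewAngle, hs, imCLM_apply, log_im]
    refine HasDerivAt.congr_of_eventuallyEq (HasDerivAt.congr_deriv him ?_) heq
    rw [imCLM_apply]
    congr 1
    simp only [Pi.div_apply]
    generalize w + t * (w' - w) = x at hp hq
    generalize w' - w = a
    field_simp
    ring

/-- A weighted sum of viewing angles whose weights form a flow is constant along each segment of
the configuration, so its limits at the two end points agree. -/
theorem sum_dirAngle_eq {ι : Type*} [Fintype ι] {p q : ι → ℂ} {C : ι → ℝ}
    (hC : ∀ g : ℂ → ℂ, ∑ i, (C i : ℂ) * (g (q i) - g (p i)) = 0) (hpq : ∀ i, p i ≠ q i)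
    {w w' : ℂ} (hw : w ≠ w') (h : ∀ i, NonCrossing (p i) (q i) w w') :
    ∑ i, C i * dirAngle (p i) (q i) w (w' - w) = ∑ i, C i * dirAngle (p i) (q i) w' (w - w') := by
  set M : ℂ → ℝ := fun x => ∑ i, C i * viewAngle (p i) (q i) x with hM
  have hlim : Tendsto (fun s : ℝ => M (w + s * (w' - w))) (𝓝[>] 0)
      (𝓝 (∑ i, C i * dirAngle (p i) (q i) w (w' - w))) :=
    tendsto_finsetSum _ fun i _ => (tendsto_viewAngle (hpq i) hw (h i)).const_mul _
  have hlim' : Tendsto (fun s : ℝ => M (w' + s * (w - w'))) (𝓝[>] 0)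
      (𝓝 (∑ i, C i * dirAngle (p i) (q i) w' (w - w'))) :=
    tendsto_finsetSum _ fun i _ =>
      (tendsto_viewAngle (hpq i) hw.symm (h i).swap_right).const_mul _
  have hderiv : ∀ t ∈ Set.Ioo (0 : ℝ) 1, HasDerivAt (fun s : ℝ => M (w + s * (w' - w))) 0 t := by
    intro t ht
    have h1 : HasDerivAt (fun s : ℝ => M (w + s * (w' - w))) _ t :=
      HasDerivAt.fun_sum (u := Finset.univ) fun i _ =>
        (hasDerivAt_viewAngle hw (h i) ht.1 ht.2).const_mul (C i)
    convert h1 using 1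
    have h2 := congrArg Complex.im (hC fun y => (w' - w) / (y - (w + t * (w' - w))))
    rw [Complex.im_sum] at h2
    have h3 : ∀ i, ((C i : ℂ) * ((w' - w) / (q i - (w + t * (w' - w))) -
        (w' - w) / (p i - (w + t * (w' - w))))).im = -(C i * ((w' - w) / (p i - (w + t * (w' - w)))
        - (w' - w) / (q i - (w + t * (w' - w)))).im) := by
      intro i
      rw [Complex.im_ofReal_mul, ← neg_sub, Complex.neg_im, mul_neg]
    simp only [h3, Finset.sum_neg_distrib, Complex.zero_im] at h2
    linarith
  have hconst : ∀ t ∈ Set.Ioo (0 : ℝ) 1, M (w + t * (w' - w)) =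
      M (w + ((1 / 2 : ℝ) : ℂ) * (w' - w)) := by
    intro t ht
    refine isOpen_Ioo.is_const_of_deriv_eq_zero (f := fun s : ℝ => M (w + s * (w' - w)))
      isPreconnected_Ioo (fun s hs => (hderiv s hs).differentiableAt.differentiableWithinAt)
      (fun s hs => (hderiv s hs).deriv) ht (by norm_num)
  have e1 := tendsto_nhds_unique (hlim.congr' (f₂ := fun _ => M (w + ((1 / 2 : ℝ) : ℂ) * (w' - w)))
    (by filter_upwards [Ioo_mem_nhdsGT (zero_lt_one' ℝ)] with s hs using hconst s hs))
    tendsto_const_nhds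
  have e2 := tendsto_nhds_unique
    (hlim'.congr' (f₂ := fun _ => M (w + ((1 / 2 : ℝ) : ℂ) * (w' - w))) (by
      filter_upwards [Ioo_mem_nhdsGT (zero_lt_one' ℝ)] with s hs
      rw [← hconst (1 - s) ⟨by linarith [hs.2], by linarith [hs.1]⟩]
      congr 1
      push_cast
      ring)) tendsto_const_nhds
  rw [e1, e2]

/-! ### Three directions at a point -/

/-- The sum of the three (shifted) angles between consecutive directions. It is `-π` if `u₁`, `u₂`,
`u₃` are in counterclockwise order, and `π` if they are in clockwise order. -/
noncomputable def turn (u₁ u₂ u₃ : ℂ) : ℝ :=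
  sarg (-u₂ / u₁) + sarg (-u₃ / u₂) + sarg (-u₁ / u₃)

theorem turn_rotate (u₁ u₂ u₃ : ℂ) : turn u₂ u₃ u₁ = turn u₁ u₂ u₃ := by
  unfold turn; ring

theorem sarg_neg_div_swap (u v : ℂ) : sarg (-u / v) = -sarg (-v / u) := by
  rw [← sarg_inv, inv_div, div_neg, neg_div]

theorem turn_swap (u₁ u₂ u₃ : ℂ) : turn u₁ u₃ u₂ = -turn u₁ u₂ u₃ := by
  unfold turn
  rw [sarg_neg_div_swap u₃ u₁, sarg_neg_div_swap u₂ u₃, sarg_neg_div_swap u₁ u₂]; ring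

theorem turn_eq {u₁ u₂ u₃ : ℂ} (h₁ : -u₂ / u₁ ∈ slitPlane) (h₂ : -u₃ / u₂ ∈ slitPlane)
    (h₃ : -u₁ / u₃ ∈ slitPlane) : turn u₁ u₂ u₃ = -Real.pi ∨ turn u₁ u₂ u₃ = Real.pi := by
  have n1 := slitPlane_ne_zero h₁
  have n2 := slitPlane_ne_zero h₂
  have n3 := slitPlane_ne_zero h₃
  have b : ∀ {z : ℂ}, z ∈ slitPlane → -Real.pi < arg z ∧ arg z < Real.pi := fun hz =>
    ⟨neg_pi_lt_arg _, lt_of_le_of_ne (arg_le_pi _) (mem_slitPlane_iff_arg.1 hz).1⟩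
  have hang : ((turn u₁ u₂ u₃ : ℝ) : Real.Angle) = (Real.pi : ℝ) := by
    rw [turn, sarg_eq_arg h₁, sarg_eq_arg h₂, sarg_eq_arg h₃, Real.Angle.coe_add,
      Real.Angle.coe_add, ← arg_mul_coe_angle n1 n2, ← arg_mul_coe_angle (mul_ne_zero n1 n2) n3]
    have : -u₂ / u₁ * (-u₃ / u₂) * (-u₁ / u₃) = -1 := by
      have m1 : u₁ ≠ 0 := by rintro rfl; simp at n1
      have m2 : u₂ ≠ 0 := by rintro rfl; simp at n1
      have m3 : u₃ ≠ 0 := by rintro rfl; simp at n2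
      field_simp
    rw [this, arg_neg_one]
  obtain ⟨k, hk⟩ := Real.Angle.angle_eq_iff_two_pi_dvd_sub.1 hang
  have hb : -(3 * Real.pi) < turn u₁ u₂ u₃ ∧ turn u₁ u₂ u₃ < 3 * Real.pi := by
    rw [turn, sarg_eq_arg h₁, sarg_eq_arg h₂, sarg_eq_arg h₃]
    have := b h₁; have := b h₂; have := b h₃
    constructor <;> linarith
  have hpi := Real.pi_pos
  have hk1 : (-2 : ℝ) < k := by
    by_contra hle; push Not at hle
    have : Real.pi * k ≤ Real.pi * (-2) := mul_le_mul_of_nonneg_left hle hpi.le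
    linarith [hb.1]
  have hk2 : (k : ℝ) < 1 := by
    by_contra hle; push Not at hle
    have : Real.pi * 1 ≤ Real.pi * k := mul_le_mul_of_nonneg_left hle hpi.le
    linarith [hb.2]
  have hk1' : -2 < k := by exact_mod_cast hk1
  have hk2' : k < 1 := by exact_mod_cast hk2
  have : k = -1 ∨ k = 0 := by omega
  rcases this with rfl | rfl
  · left; push_cast at hk; linarith
  · right; push_cast at hk; linarith

/-- The sector between the consecutive directions `u₁` and `u₂`: the left limit at `u₁` and the
right limit at `u₂` of a weighted sum of angles with total weight zero agree. -/
theorem sector_eq {u₁ u₂ u₃ : ℂ} {C₁ C₂ C₃ : ℝ} (h1 : u₁ ≠ 0) (h2 : u₂ ≠ 0)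
    (hC : C₁ + C₂ + C₃ = 0) (ht : turn u₁ u₂ u₃ = -Real.pi) :
    C₁ * sarg (-u₁ / u₁) + C₂ * sarg (-u₂ / u₁) + C₃ * sarg (-u₃ / u₁) + Real.pi * C₁ =
    C₁ * sarg (-u₁ / u₂) + C₂ * sarg (-u₂ / u₂) + C₃ * sarg (-u₃ / u₂) - Real.pi * C₂ := by
  rw [neg_div u₁ u₁, neg_div u₂ u₂, div_self h1, div_self h2, sarg_neg_one,
    sarg_neg_div_swap u₁ u₂, sarg_neg_div_swap u₃ u₁]
  unfold turn at ht
  linear_combination (Real.pi + sarg (-u₂ / u₁)) * hC - C₃ * ht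

end Angle

/-! ### The rotation of a plane drawing -/

/-- A drawing of `G` in the complex plane with explicit polygonal arcs: the edge `e` is oriented by
the dart `dart e` and drawn as the polygonal line with corners `pt e 0, …, pt e (len e)`. -/
structure PolygonalDrawing {V : Type*} (G : SimpleGraph V) where
  /-- The positions of the vertices. -/
  pos : V → ℂ
  /-- The chosen orientations of the edges. -/
  dart : G.edgeSet → G.Dart
  /-- The numbers of segments. -/
  len : G.edgeSet → ℕ
  /-- The corners. -/
  pt : G.edgeSet → ℕ → ℂ
  edge_dart : ∀ e, (dart e).edge = e
  len_pos : ∀ e, 0 < len e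
  pt_zero : ∀ e, pt e 0 = pos (dart e).fst
  pt_len : ∀ e, pt e (len e) = pos (dart e).snd
  pt_ne : ∀ e i, i < len e → pt e i ≠ pt e (i + 1)
  segment_succ : ∀ e i, i + 1 < len e → segment ℝ (pt e i) (pt e (i + 1)) ∩
    segment ℝ (pt e (i + 1)) (pt e (i + 2)) = {pt e (i + 1)}
  segment_disjoint : ∀ e i j, i + 1 < j → j < len e →
    Disjoint (segment ℝ (pt e i) (pt e (i + 1))) (segment ℝ (pt e j) (pt e (j + 1)))
  eq_or_of_pos_mem : ∀ e i, i < len e → ∀ v, pos v ∈ segment ℝ (pt e i) (pt e (i + 1)) →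
    v = (dart e).fst ∨ v = (dart e).snd
  mem_range : ∀ e f i j, e ≠ f → i < len e → j < len f →
    segment ℝ (pt e i) (pt e (i + 1)) ∩ segment ℝ (pt f j) (pt f (j + 1)) ⊆ Set.range pos

theorem IsPlanar.nonempty_polygonalDrawing {V : Type*} {G : SimpleGraph V} (h : IsPlanar G) :
    Nonempty (PolygonalDrawing G) := by
  obtain ⟨pos, arc, -, harc, hvert, hcross⟩ := h
  have hdart : ∀ e : G.edgeSet, ∃ d : G.Dart, d.edge = e := by
    rintro ⟨e, he⟩
    induction e using Sym2.ind with
    | _ u v => exact ⟨⟨(u, v), he⟩, rfl⟩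
  choose D hD using hdart
  have hpoly := fun e : G.edgeSet => harc _ _ (D e).adj
  have hDe : ∀ e : G.edgeSet, s((D e).fst, (D e).snd) = (e : Sym2 V) := hD
  simp only [hDe] at hpoly
  choose n c hn h0 hlast hne hsucc hdisj hA using hpoly
  let F : (ℝ × ℝ) →ₗ[ℝ] ℂ := Complex.equivRealProdLm.symm.toLinearMap
  have hF : Function.Injective F := Complex.equivRealProdLm.symm.injective
  have hseg : ∀ a b, segment ℝ (F a) (F b) = F '' segment ℝ a b := fun a b =>
    (image_segment ℝ F.toAffineMap a b).symm
  have hsub : ∀ e i, i < n e → segment ℝ (c e i) (c e (i + 1)) ⊆ arc e := fun e i hi => by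
    rw [hA e]
    exact Set.subset_biUnion_of_mem (u := fun i => segment ℝ (c e i) (c e (i + 1))) hi
  refine ⟨⟨F ∘ pos, D, n, fun e i => F (c e i), hD, hn, fun e => ?_, fun e => ?_,
    fun e i hi h => hne e i hi (hF h), fun e i hi => ?_, fun e i j hij hj => ?_,
    fun e i hi v hv => ?_, fun e f i j hef hi hj => ?_⟩⟩
  · simp [h0]
  · simp [hlast]
  · rw [hseg, hseg, ← Set.image_inter hF, hsucc e i hi, Set.image_singleton]
  · rw [hseg, hseg, Set.disjoint_image_iff hF]
    exact hdisj e i j hij hj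
  · rw [hseg] at hv
    obtain ⟨x, hx, hxv⟩ := hv
    refine hvert _ _ v (D e).adj ?_
    rw [hDe, ← hF hxv]
    exact hsub e i hi hx
  · rw [hseg, hseg, ← Set.image_inter hF]
    rintro _ ⟨x, ⟨hx1, hx2⟩, rfl⟩
    obtain ⟨v, rfl⟩ := hcross e e.2 f f.2 (fun h => hef (Subtype.ext h))
      ⟨hsub e i hi hx1, hsub f j hj hx2⟩
    exact ⟨v, rfl⟩

namespace PolygonalDrawing

variable {V : Type*} {G : SimpleGraph V} (D : PolygonalDrawing G)

theorem eq_or_of_pt_mem {e : G.edgeSet} {i k : ℕ} (hi : i ≤ D.len e) (hk : k < D.len e)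
    (h : D.pt e i ∈ segment ℝ (D.pt e k) (D.pt e (k + 1))) : i = k ∨ i = k + 1 := by
  by_contra! hne
  rcases lt_or_ge i k with hik | hik
  · rcases (show i + 1 ≤ k by omega).lt_or_eq with h1 | rfl
    · exact Set.disjoint_left.1 (D.segment_disjoint e i k h1 hk) (left_mem_segment ℝ _ _) h
    · have : D.pt e i ∈ ({D.pt e (i + 1)} : Set ℂ) := by
        rw [← D.segment_succ e i hk]
        exact ⟨left_mem_segment ℝ _ _, h⟩
      exact D.pt_ne e i (by omega) this
  · obtain ⟨j, rfl⟩ : ∃ j, i = j + 1 := ⟨i - 1, by omega⟩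
    rcases (show k + 1 ≤ j by omega).lt_or_eq with h1 | rfl
    · exact Set.disjoint_left.1 (D.segment_disjoint e k j h1 (by omega)) h
        (right_mem_segment ℝ _ _)
    · have : D.pt e (k + 1 + 1) ∈ ({D.pt e (k + 1)} : Set ℂ) := by
        rw [← D.segment_succ e k (by omega)]
        exact ⟨h, right_mem_segment ℝ _ _⟩
      exact D.pt_ne e (k + 1) (by omega) (Set.mem_singleton_iff.1 this).symm

theorem eq_or_of_pt_eq_pos {e : G.edgeSet} {i : ℕ} {v : V} (hi : i ≤ D.len e)
    (h : D.pt e i = D.pos v) :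
    (i = 0 ∧ v = (D.dart e).fst) ∨ (i = D.len e ∧ v = (D.dart e).snd) := by
  have hlen := D.len_pos e
  have hmem : ∃ k < D.len e, D.pt e i ∈ segment ℝ (D.pt e k) (D.pt e (k + 1)) := by
    rcases hi.lt_or_eq with h1 | h1
    · exact ⟨i, h1, left_mem_segment ℝ _ _⟩
    · refine ⟨i - 1, by omega, ?_⟩
      rw [show i - 1 + 1 = i by omega]
      exact right_mem_segment ℝ _ _
  obtain ⟨k, hk, hk'⟩ := hmem
  rcases D.eq_or_of_pos_mem e k hk v (h ▸ hk') with rfl | rfl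
  · left
    refine ⟨?_, rfl⟩
    rw [← D.pt_zero] at h
    rcases D.eq_or_of_pt_mem hi hlen (h ▸ left_mem_segment ℝ _ _) with h1 | h1
    · exact h1
    · exfalso
      rw [h1] at h
      exact D.pt_ne e 0 hlen h.symm
  · right
    refine ⟨?_, rfl⟩
    rw [← D.pt_len] at h
    have h2 : D.len e - 1 + 1 = D.len e := by omega
    rcases D.eq_or_of_pt_mem (k := D.len e - 1) hi (by omega)
      (by rw [h2, h]; exact right_mem_segment ℝ _ _) with h1 | h1
    · exfalso
      rw [h1] at h
      exact D.pt_ne e (D.len e - 1) (by omega) (by rw [h2, h])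
    · omega

theorem mem_pair_of_pos_mem {e : G.edgeSet} {i : ℕ} {v : V} (hi : i < D.len e)
    (h : D.pos v ∈ segment ℝ (D.pt e i) (D.pt e (i + 1))) :
    D.pos v ∈ ({D.pt e i, D.pt e (i + 1)} : Set ℂ) := by
  rcases D.eq_or_of_pos_mem e i hi v h with rfl | rfl
  · rw [← D.pt_zero] at h ⊢
    rcases D.eq_or_of_pt_mem (by omega) hi h with h1 | h1
    · left; rw [← h1]
    · omega
  · rw [← D.pt_len] at h ⊢
    rcases D.eq_or_of_pt_mem le_rfl hi h with h1 | h1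
    · omega
    · right; rw [h1]; rfl

theorem segment_inter_subset {e f : G.edgeSet} {i j : ℕ} (hef : e ≠ f) (hi : i < D.len e)
    (hj : j < D.len f) :
    segment ℝ (D.pt e i) (D.pt e (i + 1)) ∩ segment ℝ (D.pt f j) (D.pt f (j + 1)) ⊆
      {D.pt e i, D.pt e (i + 1)} ∩ {D.pt f j, D.pt f (j + 1)} := by
  intro x hx
  obtain ⟨v, rfl⟩ := D.mem_range e f i j hef hi hj hx
  exact ⟨D.mem_pair_of_pos_mem hi hx.1, D.mem_pair_of_pos_mem hj hx.2⟩

theorem nonCrossing {e f : G.edgeSet} {i j : ℕ} (hi : i < D.len e) (hj : j < D.len f) :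
    NonCrossing (D.pt e i) (D.pt e (i + 1)) (D.pt f j) (D.pt f (j + 1)) := by
  by_cases hef : e = f
  · subst hef
    rcases lt_trichotomy i j with h | rfl | h
    · right; right
      rcases (show i + 1 ≤ j by omega).lt_or_eq with h1 | rfl
      · rw [Set.disjoint_iff_inter_eq_empty.1 (D.segment_disjoint e i j h1 hj)]
        exact Set.empty_subset _
      · rw [D.segment_succ e i hj]
        simp
    · exact Or.inl ⟨rfl, rfl⟩
    · right; right
      rcases (show j + 1 ≤ i by omega).lt_or_eq with h1 | rfl
      · rw [Set.inter_comm, Set.disjoint_iff_inter_eq_empty.1 (D.segment_disjoint e j i h1 hi)]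
        exact Set.empty_subset _
      · rw [Set.inter_comm, D.segment_succ e j hi]
        simp
  · exact Or.inr (Or.inr (D.segment_inter_subset hef hi hj))

theorem edge_dart_symm (e : G.edgeSet) : (D.dart e).symm.edge = e := by
  rw [Dart.edge_symm, D.edge_dart]

theorem eq_dart_or (d : G.Dart) : ∃ e, d = D.dart e ∨ d = (D.dart e).symm := by
  refine ⟨⟨d.edge, d.edge_mem⟩, ?_⟩
  have h : (D.dart ⟨d.edge, d.edge_mem⟩).edge = d.edge := D.edge_dart _
  exact dart_edge_eq_iff _ _ |>.1 h.symm

theorem pt_ne_of_ne {e f : G.edgeSet} {i k : ℕ} (hi : i ≤ D.len f) (hk : k + 1 < D.len e)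
    (h : f ≠ e ∨ i ≠ k + 1) : D.pt f i ≠ D.pt e (k + 1) := by
  intro heq
  obtain ⟨j, hj, hij, hmem⟩ : ∃ j < D.len f, (i = j ∨ i = j + 1) ∧
      D.pt f i ∈ segment ℝ (D.pt f j) (D.pt f (j + 1)) := by
    rcases hi.lt_or_eq with h1 | h1
    · exact ⟨i, h1, Or.inl rfl, left_mem_segment ℝ _ _⟩
    · have := D.len_pos f
      refine ⟨i - 1, by omega, by omega, ?_⟩
      rw [show i - 1 + 1 = i by omega]
      exact right_mem_segment ℝ _ _
  by_cases hfe : f = e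
  · subst hfe
    have h1 := D.eq_or_of_pt_mem hi (k := k) (by omega) (heq ▸ right_mem_segment ℝ _ _)
    have h2 := D.eq_or_of_pt_mem hi (k := k + 1) (by omega) (heq ▸ left_mem_segment ℝ _ _)
    have h3 : i ≠ k + 1 := h.resolve_left (by simp)
    omega
  · obtain ⟨v, hv⟩ := D.mem_range f e j k hfe hj (by omega)
      ⟨hmem, heq ▸ right_mem_segment ℝ _ _⟩
    rcases D.eq_or_of_pt_eq_pos (i := k + 1) (by omega) (heq ▸ hv.symm) with h1 | h1 <;> omega

theorem sum_dart_eq [Fintype V] [DecidableRel G.Adj] (H : G.Dart → ℝ) :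
    ∑ d, H d = ∑ e, (H (D.dart e) + H (D.dart e).symm) := by
  classical
  rw [← Finset.sum_fiberwise Finset.univ (fun d : G.Dart => (⟨d.edge, d.edge_mem⟩ : G.edgeSet)) H]
  refine Finset.sum_congr rfl fun e _ => ?_
  rw [← Finset.sum_pair (D.dart e).symm_ne.symm]
  refine Finset.sum_congr ?_ fun _ _ => rfl
  ext d
  simp only [Finset.mem_filter, Finset.mem_univ, true_and, Finset.mem_insert,
    Finset.mem_singleton, Subtype.ext_iff, ← dart_edge_eq_iff, D.edge_dart]

variable [DecidableEq V]

/-- The direction in which the arc of `d` leaves the initial vertex of `d`. -/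
noncomputable def dir (d : G.Dart) : ℂ :=
  (if D.dart ⟨d.edge, d.edge_mem⟩ = d then D.pt ⟨d.edge, d.edge_mem⟩ 1
    else D.pt ⟨d.edge, d.edge_mem⟩ (D.len ⟨d.edge, d.edge_mem⟩ - 1)) - D.pos d.fst

theorem dir_dart (e : G.edgeSet) : D.dir (D.dart e) = D.pt e 1 - D.pt e 0 := by
  have h : (⟨(D.dart e).edge, (D.dart e).edge_mem⟩ : G.edgeSet) = e := Subtype.ext (D.edge_dart e)
  rw [dir, h, if_pos rfl, D.pt_zero]

theorem dir_dart_symm (e : G.edgeSet) :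
    D.dir (D.dart e).symm = D.pt e (D.len e - 1) - D.pt e (D.len e) := by
  have h : (⟨(D.dart e).symm.edge, (D.dart e).symm.edge_mem⟩ : G.edgeSet) = e :=
    Subtype.ext (D.edge_dart_symm e)
  rw [dir, h, if_neg (D.dart e).symm_ne.symm, D.pt_len]
  rfl

/-- The initial segment of each dart. -/
theorem exists_segment (d : G.Dart) : ∃ (e : G.edgeSet) (i : ℕ), d.edge = e ∧ i < D.len e ∧
    D.dir d ≠ 0 ∧
    segment ℝ (D.pos d.fst) (D.pos d.fst + D.dir d) = segment ℝ (D.pt e i) (D.pt e (i + 1)) ∧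
      ({D.pos d.fst, D.pos d.fst + D.dir d} : Set ℂ) = {D.pt e i, D.pt e (i + 1)} := by
  obtain ⟨e, rfl | rfl⟩ := D.eq_dart_or d
  · refine ⟨e, 0, D.edge_dart e, D.len_pos e, ?_, ?_, ?_⟩
    · rw [dir_dart, sub_ne_zero]
      exact (D.pt_ne e 0 (D.len_pos e)).symm
    · rw [dir_dart, D.pt_zero]
      simp
    · rw [dir_dart, D.pt_zero]
      simp
  · have hlen := D.len_pos e
    have h2 : D.len e - 1 + 1 = D.len e := by omega
    have h3 := D.pt_ne e (D.len e - 1) (by omega)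
    rw [h2] at h3
    refine ⟨e, D.len e - 1, D.edge_dart_symm e, by omega, ?_, ?_, ?_⟩
    · rw [dir_dart_symm, sub_ne_zero]
      exact h3
    · rw [dir_dart_symm, h2, segment_symm, show (D.dart e).symm.fst = (D.dart e).snd from rfl,
        ← D.pt_len]
      simp
    · rw [dir_dart_symm, h2, Set.pair_comm, show (D.dart e).symm.fst = (D.dart e).snd from rfl,
        ← D.pt_len]
      simp

theorem dir_ne_zero (d : G.Dart) : D.dir d ≠ 0 := by
  obtain ⟨_, _, _, _, h, _, _⟩ := D.exists_segment d
  exact h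

theorem neg_dir_div_mem {d d' : G.Dart} (hne : d ≠ d') (hfst : d.fst = d'.fst) :
    -D.dir d / D.dir d' ∈ Complex.slitPlane := by
  obtain ⟨e, i, he, hi, hd, hs, hp⟩ := D.exists_segment d
  obtain ⟨f, j, hf, hj, hd', hs', hp'⟩ := D.exists_segment d'
  have hef : e ≠ f := by
    rintro rfl
    rcases (dart_edge_eq_iff _ _).1 (he.trans hf.symm) with h | h
    · exact hne h
    · have := congrArg (fun x : G.Dart => x.fst) h
      exact d'.adj.ne (hfst.symm.trans this)
  have hsub := D.segment_inter_subset hef hi hj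
  rw [← hs, ← hs', ← hp, ← hp', ← hfst] at hsub
  have key := neg_div_mem_slitPlane (w := D.pos d.fst) (q := D.pos d.fst + D.dir d)
    (w' := D.pos d.fst + D.dir d') (by simpa using hd) (by simpa using hd')
    (hsub.trans Set.inter_subset_right)
  simpa using key

/-- The three darts `d`, `x`, `y` leave the same vertex in counterclockwise order. -/
def IsCcw (d x y : G.Dart) : Prop :=
  x.fst = d.fst ∧ y.fst = d.fst ∧ d ≠ x ∧ x ≠ y ∧ y ≠ d ∧
    turn (D.dir d) (D.dir x) (D.dir y) = -Real.pi

theorem IsCcw.rotate {D : PolygonalDrawing G} {d x y : G.Dart}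
    (h : D.IsCcw d x y) : D.IsCcw x y d := by
  obtain ⟨h1, h2, h3, h4, h5, h6⟩ := h
  exact ⟨h2.trans h1.symm, h1.symm, h4, h5, h3, by rw [turn_rotate]; exact h6⟩

variable [Fintype V] [DecidableRel G.Adj]

/-- The segments of the drawing. -/
abbrev Idx : Type _ := Σ e : G.edgeSet, Fin (D.len e)

/-- The limit at `w` along the direction `a` of the sum of the viewing angles of all segments of
the drawing, weighted with the flow `C`. -/
noncomputable def angleSum (C : G.Dart → ℝ) (w a : ℂ) : ℝ :=
  ∑ i : D.Idx, C (D.dart i.1) * dirAngle (D.pt i.1 i.2) (D.pt i.1 (i.2 + 1)) w a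

theorem flow_conservation {C : G.Dart → ℝ} (hC : IsFlow C) (g : V → ℝ) :
    ∑ e, C (D.dart e) * (g (D.dart e).snd - g (D.dart e).fst) = 0 := by
  have h : ∑ d : G.Dart, C d * g d.fst = 0 := by
    rw [← Finset.sum_fiberwise Finset.univ (fun d : G.Dart => d.fst)]
    refine Finset.sum_eq_zero fun v _ => ?_
    rw [Finset.sum_congr rfl (g := fun d => C d * g v), ← Finset.sum_mul, hC.div, zero_mul]
    intro d hd
    rw [(Finset.mem_filter.1 hd).2]
  rw [D.sum_dart_eq] at h
  rw [← neg_eq_zero, ← Finset.sum_neg_distrib, ← h]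
  refine Finset.sum_congr rfl fun e _ => ?_
  rw [hC.symm]
  change _ = _ + -C (D.dart e) * g (D.dart e).snd
  ring

theorem idx_conservation {C : G.Dart → ℝ} (hC : IsFlow C) (g : ℂ → ℂ) :
    ∑ i : D.Idx, (C (D.dart i.1) : ℂ) * (g (D.pt i.1 (i.2 + 1)) - g (D.pt i.1 i.2)) = 0 := by
  rw [Fintype.sum_sigma]
  have h : ∀ e : G.edgeSet, ∑ k : Fin (D.len e), (C (D.dart e) : ℂ) *
      (g (D.pt e (k + 1)) - g (D.pt e k)) = (C (D.dart e) : ℂ) *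
      (g (D.pos (D.dart e).snd) - g (D.pos (D.dart e).fst)) := by
    intro e
    rw [← Finset.mul_sum, Fin.sum_univ_eq_sum_range (fun k => g (D.pt e (k + 1)) - g (D.pt e k)),
      Finset.sum_range_sub (fun k => g (D.pt e k)), D.pt_len, D.pt_zero]
  rw [Finset.sum_congr rfl fun e _ => h e]
  apply Complex.ext
  · rw [Complex.re_sum]
    simp only [Complex.re_ofReal_mul, Complex.sub_re, Complex.zero_re]
    exact D.flow_conservation hC fun v => (g (D.pos v)).re
  · rw [Complex.im_sum]
    simp only [Complex.im_ofReal_mul, Complex.sub_im, Complex.zero_im]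
    exact D.flow_conservation hC fun v => (g (D.pos v)).im

theorem angleSum_segment {C : G.Dart → ℝ} (hC : IsFlow C) {e : G.edgeSet} {k : ℕ}
    (hk : k < D.len e) :
    D.angleSum C (D.pt e k) (D.pt e (k + 1) - D.pt e k) =
      D.angleSum C (D.pt e (k + 1)) (D.pt e k - D.pt e (k + 1)) :=
  sum_dirAngle_eq (D.idx_conservation hC) (fun i => D.pt_ne _ _ i.2.2) (D.pt_ne e k hk)
    fun i => D.nonCrossing i.2.2 hk

/-- At an interior corner of an arc, the limits along the two adjacent segments agree. -/
theorem angleSum_corner (C : G.Dart → ℝ) {e : G.edgeSet} {k : ℕ} (hk : k + 1 < D.len e) :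
    D.angleSum C (D.pt e (k + 1)) (D.pt e k - D.pt e (k + 1)) =
      D.angleSum C (D.pt e (k + 1)) (D.pt e (k + 2) - D.pt e (k + 1)) := by
  rw [← sub_eq_zero, angleSum, angleSum, ← Finset.sum_sub_distrib]
  have hne := D.pt_ne e k (by omega)
  have hne' := D.pt_ne e (k + 1) hk
  rw [Fintype.sum_eq_add (⟨e, ⟨k, by omega⟩⟩ : D.Idx) ⟨e, ⟨k + 1, hk⟩⟩ (by simp)]
  · have h1 : D.pt e k - D.pt e (k + 1) ≠ 0 := sub_ne_zero.2 hne
    have h2 : D.pt e (k + 1 + 1) - D.pt e (k + 1) ≠ 0 := sub_ne_zero.2 hne'.symm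
    simp only [dirAngle, if_neg hne, if_true]
    rw [neg_div, div_self h1, neg_div (D.pt e (k + 1 + 1) - D.pt e (k + 1)) (D.pt e (k + 2) - _),
      div_self h2, sarg_neg_one, sarg_neg_div_swap (D.pt e k - D.pt e (k + 1))]
    ring
  · rintro ⟨f, i, hi⟩ ⟨hi1, hi2⟩
    have hcase : f ≠ e ∨ (i ≠ k ∧ i ≠ k + 1) := by
      by_contra! hcon
      obtain ⟨rfl, hcon⟩ := hcon
      by_cases h : i = k
      · subst h; exact hi1 rfl
      · have := hcon h
        subst this; exact hi2 rfl
    simp only []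
    rw [dirAngle_congr (D.pt_ne_of_ne hi.le hk (hcase.imp_right fun h => h.2))
      (D.pt_ne_of_ne hi hk (hcase.imp_right fun h => by omega)), sub_self]

/-- The common limit of the angle sum along the interior of the arc of `e`. -/
noncomputable def arcValue (C : G.Dart → ℝ) (e : G.edgeSet) : ℝ :=
  D.angleSum C (D.pt e 0) (D.pt e 1 - D.pt e 0)

theorem angleSum_eq_arcValue {C : G.Dart → ℝ} (hC : IsFlow C) {e : G.edgeSet} {k : ℕ}
    (hk : k < D.len e) :
    D.angleSum C (D.pt e k) (D.pt e (k + 1) - D.pt e k) = D.arcValue C e := by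
  induction k with
  | zero => rfl
  | succ k ih =>
    rw [← ih (by omega), D.angleSum_segment hC (k := k) (by omega), D.angleSum_corner C hk]

theorem angleSum_dir {C : G.Dart → ℝ} (hC : IsFlow C) (d : G.Dart) :
    D.angleSum C (D.pos d.fst) (D.dir d) = D.arcValue C ⟨d.edge, d.edge_mem⟩ := by
  obtain ⟨e, hd⟩ := D.eq_dart_or d
  have he : (⟨d.edge, d.edge_mem⟩ : G.edgeSet) = e := by
    apply Subtype.ext
    rcases hd with rfl | rfl
    · exact D.edge_dart e
    · exact D.edge_dart_symm e
  rw [he]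
  rcases hd with rfl | rfl
  · rw [dir_dart, ← D.pt_zero]
    rfl
  · have hlen := D.len_pos e
    have h2 : D.len e - 1 + 1 = D.len e := by omega
    have h := D.angleSum_segment hC (e := e) (k := D.len e - 1) (by omega)
    rw [D.angleSum_eq_arcValue hC (by omega), h2] at h
    rw [dir_dart_symm, show (D.dart e).symm.fst = (D.dart e).snd from rfl, ← D.pt_len, h]

/-- Only the arcs that leave `v` contribute to the dependence of the angle sum at `v` on the
direction. -/
theorem angleSum_sub {C : G.Dart → ℝ} (hC : IsFlow C) (v : V) (a b : ℂ) :
    D.angleSum C (D.pos v) a - D.angleSum C (D.pos v) b =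
      ∑ d with d.fst = v, (C d * sarg (-D.dir d / a) - C d * sarg (-D.dir d / b)) := by
  rw [Finset.sum_filter, D.sum_dart_eq, angleSum, angleSum, ← Finset.sum_sub_distrib,
    Fintype.sum_sigma]
  refine Finset.sum_congr rfl fun e _ => ?_
  have hlen := D.len_pos e
  have hfs : (D.dart e).fst ≠ (D.dart e).snd := (D.dart e).adj.ne
  have hzero : ∀ i : Fin (D.len e), D.pt e i ≠ D.pos v → D.pt e (i + 1) ≠ D.pos v →
      C (D.dart e) * dirAngle (D.pt e i) (D.pt e (i + 1)) (D.pos v) a -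
        C (D.dart e) * dirAngle (D.pt e i) (D.pt e (i + 1)) (D.pos v) b = 0 := by
    intro i h1 h2
    rw [dirAngle_congr h1 h2 a b, sub_self]
  change _ = _ + if (D.dart e).snd = v then _ else _
  by_cases h1 : (D.dart e).fst = v
  · subst h1
    rw [if_pos rfl, if_neg hfs.symm, add_zero, Fintype.sum_eq_single ⟨0, hlen⟩]
    · simp only [dirAngle, zero_add, D.pt_zero, dir_dart, if_true]
    · rintro ⟨i, hi⟩ hne
      have hne' : i ≠ 0 := fun h => hne (by subst h; rfl)
      refine hzero _ (fun h => ?_) (fun h => ?_)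
      · rcases D.eq_or_of_pt_eq_pos hi.le h with h | h
        · exact hne' h.1
        · exact hfs h.2
      · rcases D.eq_or_of_pt_eq_pos (i := i + 1) hi h with h | h
        · omega
        · exact hfs h.2
  · rw [if_neg h1, zero_add]
    by_cases h2 : (D.dart e).snd = v
    · subst h2
      have h3 : D.len e - 1 + 1 = D.len e := by omega
      have h4 : D.pt e (D.len e - 1) ≠ D.pt e (D.len e) := by
        have := D.pt_ne e (D.len e - 1) (by omega)
        rwa [h3] at this
      rw [if_pos rfl, Fintype.sum_eq_single ⟨D.len e - 1, by omega⟩]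
      · simp only [dirAngle, dir_dart_symm, h3, ← D.pt_len, if_neg h4, if_true, hC.symm]
        ring
      · rintro ⟨i, hi⟩ hne
        have hne' : i ≠ D.len e - 1 := fun h => hne (by subst h; rfl)
        refine hzero _ (fun h => ?_) (fun h => ?_)
        · rcases D.eq_or_of_pt_eq_pos hi.le h with h | h
          · exact hfs h.2.symm
          · omega
        · rcases D.eq_or_of_pt_eq_pos (i := i + 1) hi h with h | h
          · omega
          · omega
    · rw [if_neg h2]
      refine Finset.sum_eq_zero fun i _ => hzero i (fun h => ?_) (fun h => ?_)
      · rcases D.eq_or_of_pt_eq_pos i.2.le h with h | h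
        · exact h1 h.2.symm
        · exact h2 h.2.symm
      · rcases D.eq_or_of_pt_eq_pos (i := i + 1) i.2 h with h | h
        · exact h1 h.2.symm
        · exact h2 h.2.symm

variable {D}

theorem IsCcw.filter_eq (hreg : G.IsRegularOfDegree 3) {d x y : G.Dart} (h : D.IsCcw d x y) :
    (Finset.univ.filter fun e : G.Dart => e.fst = d.fst) = {d, x, y} := by
  obtain ⟨h1, h2, h3, h4, h5, h6⟩ := h
  symm
  apply Finset.eq_of_subset_of_card_le
  · intro e he
    simp only [Finset.mem_insert, Finset.mem_singleton] at he
    rcases he with rfl | rfl | rfl <;> simp [*]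
  · rw [dart_fst_fiber_card_eq_degree, hreg, Finset.card_eq_three.2 ⟨d, x, y, h3, h5.symm, h4, rfl⟩]

theorem IsCcw.unique (hreg : G.IsRegularOfDegree 3) {d x y x' y' : G.Dart} (h : D.IsCcw d x y)
    (h' : D.IsCcw d x' y') : x' = x := by
  have hf := h.filter_eq hreg
  obtain ⟨h1, h2, h3, h4, h5, h6⟩ := h
  obtain ⟨h1', h2', h3', h4', h5', h6'⟩ := h'
  have hx : x' ∈ ({d, x, y} : Finset G.Dart) := by rw [← hf]; simp [h1']
  have hy : y' ∈ ({d, x, y} : Finset G.Dart) := by rw [← hf]; simp [h2']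
  simp only [Finset.mem_insert, Finset.mem_singleton] at hx hy
  rcases hx with rfl | rfl | rfl
  · exact absurd rfl h3'
  · rfl
  · rcases hy with rfl | rfl | rfl
    · exact absurd rfl h5'
    · rw [turn_swap, h6] at h6'
      have := Real.pi_pos
      linarith
    · exact absurd rfl h4'

variable (D)

theorem exists_isCcw (hreg : G.IsRegularOfDegree 3) (d : G.Dart) : ∃ x y, D.IsCcw d x y := by
  have hcard : ((Finset.univ.filter fun e : G.Dart => e.fst = d.fst).erase d).card = 2 := by
    rw [Finset.card_erase_of_mem (by simp), dart_fst_fiber_card_eq_degree, hreg]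
  obtain ⟨x, y, hxy, hset⟩ := Finset.card_eq_two.1 hcard
  have hx : x ∈ ({x, y} : Finset G.Dart) := by simp
  have hy : y ∈ ({x, y} : Finset G.Dart) := by simp
  rw [← hset] at hx hy
  simp only [Finset.mem_erase, Finset.mem_filter, Finset.mem_univ, true_and] at hx hy
  rcases turn_eq (D.neg_dir_div_mem hx.1 hx.2) (D.neg_dir_div_mem hxy.symm (hy.2.trans hx.2.symm))
    (D.neg_dir_div_mem hy.1.symm hy.2.symm) with h | h
  · exact ⟨x, y, hx.2, hy.2, hx.1.symm, hxy, hy.1, h⟩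
  · refine ⟨y, x, hy.2, hx.2, hy.1.symm, hxy.symm, hx.1, ?_⟩
    rw [turn_swap, h]

/-- The potential of a flow `C` to the left of a dart `d` is the mean of the limits on the two
sides, which is `arcValue`, plus half of the jump `2π C d`. -/
theorem left_eq_right {C : G.Dart → ℝ} (hC : IsFlow C) (hreg : G.IsRegularOfDegree 3)
    {d x y : G.Dart} (h : D.IsCcw d x y) :
    D.arcValue C ⟨d.edge, d.edge_mem⟩ + Real.pi * C d =
      D.arcValue C ⟨x.edge, x.edge_mem⟩ - Real.pi * C x := by
  have hf := h.filter_eq hreg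
  obtain ⟨h1, h2, h3, h4, h5, h6⟩ := h
  have hsum : C d + C x + C y = 0 := by
    have := hC.div d.fst
    rw [hf, Finset.sum_insert (by simp [h3, h5.symm]), Finset.sum_pair h4] at this
    linarith
  have hsub := D.angleSum_sub hC d.fst (D.dir d) (D.dir x)
  rw [hf, Finset.sum_insert (by simp [h3, h5.symm]), Finset.sum_pair h4, D.angleSum_dir hC, ← h1,
    D.angleSum_dir hC] at hsub
  have := sector_eq (D.dir_ne_zero d) (D.dir_ne_zero x) hsum h6
  linarith

theorem exists_isPlaneRotation (D : PolygonalDrawing G) (hreg : G.IsRegularOfDegree 3) :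
    ∃ σ : Equiv.Perm G.Dart, IsPlaneRotation σ := by
  choose σ ρ hσ using D.exists_isCcw hreg
  have h2 : ∀ d, σ (σ d) = ρ d := fun d => (hσ d).rotate.unique hreg (hσ (σ d))
  have h3 : ∀ d, σ (σ (σ d)) = d := fun d => by
    rw [h2 d]
    exact (hσ d).rotate.rotate.unique hreg (hσ (ρ d))
  refine ⟨⟨σ, fun d => σ (σ d), h3, h3⟩, fun d => (hσ d).1, fun d => (hσ d).2.2.1.symm, h3,
    fun C hC => ⟨fun d => (D.arcValue C ⟨d.edge, d.edge_mem⟩ + Real.pi * C d) / (2 * Real.pi),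
      fun d => ⟨?_, ?_⟩⟩⟩
  · have h := D.left_eq_right hC hreg (hσ d)
    change (D.arcValue C ⟨d.edge, d.edge_mem⟩ + Real.pi * C d) / _ =
      (D.arcValue C ⟨(σ d).symm.edge, (σ d).symm.edge_mem⟩ + Real.pi * C (σ d).symm) / _
    rw [h, hC.symm]
    simp only [Dart.edge_symm]
    ring
  · simp only [hC.symm, Dart.edge_symm]
    field_simp
    ring

end PolygonalDrawing

/-! ### Cycles of length at most ten -/

theorem IsPlanar.exists_isPlaneRotation {V : Type*} [Fintype V] [DecidableEq V]
    {G : SimpleGraph V} [DecidableRel G.Adj] (h : IsPlanar G) (hreg : G.IsRegularOfDegree 3) :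
    ∃ σ : Equiv.Perm G.Dart, IsPlaneRotation σ :=
  h.nonempty_polygonalDrawing.elim fun D => D.exists_isPlaneRotation hreg

/-- A 2-connected cubic planar graph has a cycle of length at most `5`, and a cycle of length
between `4` and `10`. -/
theorem IsPlanar.exists_short_cycles {V : Type*} [Fintype V]
    {G : SimpleGraph V} [DecidableRel G.Adj] (h : IsPlanar G) (hreg : G.IsRegularOfDegree 3)
    (hconn : IsKConnected 2 G) :
    (∃ n ∈ cycleSpectrum G, n ≤ 5) ∧ ∃ n ∈ cycleSpectrum G, 4 ≤ n ∧ n ≤ 10 := by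
  classical
  obtain ⟨σ, hσ⟩ := h.exists_isPlaneRotation hreg
  have hface : ∀ d, face σ d ≠ face σ d.symm := fun d =>
    hσ.face_ne_face_symm (exists_isFlow_ne_zero hconn hreg d)
  have hne : Nonempty G.Dart := by
    have hV : 0 < Fintype.card V := by have := hconn.1; omega
    obtain ⟨v⟩ := Fintype.card_pos_iff.1 hV
    have : 0 < G.degree v := by rw [hreg]; norm_num
    obtain ⟨w, hw⟩ := (G.degree_pos_iff_exists_adj v).1 this
    exact ⟨⟨(v, w), hw⟩⟩
  exact ⟨hσ.exists_mem_cycleSpectrum_le_five hreg hface,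
    hσ.exists_mem_cycleSpectrum_Icc hreg hface⟩

theorem not_isGap_of_lt {V : Type*} [Fintype V]
    {G : SimpleGraph V} [DecidableRel G.Adj] (h : IsPlanar G) (hreg : G.IsRegularOfDegree 3)
    (hconn : IsKConnected 2 G) {a b : ℕ} (hgap : IsGap G a b) :
    (a = 3 → b ≤ 4) ∧ (a = 4 → b ≤ 9) := by
  obtain ⟨⟨m, hm, hm5⟩, n, hn, hn4, hn10⟩ := h.exists_short_cycles hreg hconn
  have hno : ∀ k ∈ cycleSpectrum G, a ≤ k → k ≤ b → False := fun k hk ha hb => by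
    have : k ∈ cycleSpectrum G ∩ Set.Icc a b := ⟨hk, ha, hb⟩
    rw [hgap.1] at this
    exact this
  have hm3 : 3 ≤ m := by
    obtain ⟨v, c, hc, rfl⟩ := hm
    exact hc.three_le_length
  constructor
  · rintro rfl
    by_contra hb
    exact hno m hm hm3 (by omega)
  · rintro rfl
    by_contra hb
    exact hno n hn hn4 (by omega)

/-! ### Hamiltonian cubic graphs -/

section Chord

variable {V : Type*}

/-- The graph on `V` in which `v` is adjacent to its successor `s v` and to `f v`. -/
def chordGraph (s : Equiv.Perm V) (f : V → V) : SimpleGraph V :=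
  SimpleGraph.fromRel fun u v => s u = v ∨ f u = v

instance [DecidableEq V] (s : Equiv.Perm V) (f : V → V) : DecidableRel (chordGraph s f).Adj :=
  fun u v => inferInstanceAs (Decidable (u ≠ v ∧ ((s u = v ∨ f u = v) ∨ (s v = u ∨ f v = u))))

theorem chordGraph_orientation {s : Equiv.Perm V} {f : V → V} {E : V → V → Prop}
    (hs : ∀ u, E u (s u) ∨ E (s u) u) (hf : ∀ u, E u (f u) ∨ E (f u) u) (u v : V)
    (h : (chordGraph s f).Adj u v) : E u v ∨ E v u := by
  obtain ⟨-, (rfl | rfl) | (rfl | rfl)⟩ := h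
  · exact hs u
  · exact hf u
  · exact (hs v).symm
  · exact (hf v).symm

/-- Conditions for `chordGraph s f` to be a Hamiltonian cubic graph: `s` permutes the vertices
cyclically, and `f` is an involution that pairs vertices which are not consecutive. -/
structure IsChordData (s : Equiv.Perm V) (f : V → V) : Prop where
  invol : ∀ v, f (f v) = v
  succ_ne : ∀ v, s v ≠ v
  succ_succ_ne : ∀ v, s (s v) ≠ v
  chord_ne : ∀ v, f v ≠ v
  chord_ne_succ : ∀ v, f v ≠ s v
  succ_chord_ne : ∀ v, s (f v) ≠ v
  sameCycle : ∀ u v, s.SameCycle u v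

namespace IsChordData

variable {s : Equiv.Perm V} {f : V → V} (h : IsChordData s f)
include h

theorem adj_iff {u v : V} :
    (chordGraph s f).Adj u v ↔ v = s u ∨ v = s.symm u ∨ v = f u := by
  have hs : v = s.symm u ↔ s v = u := by rw [Equiv.eq_symm_apply]
  have hf : f v = u ↔ v = f u := by
    constructor
    · rintro rfl; exact (h.invol v).symm
    · rintro rfl; exact h.invol u
  rw [chordGraph, SimpleGraph.fromRel_adj, hs, hf]
  constructor
  · rintro ⟨-, (h1 | h1) | (h1 | h1)⟩
    · exact Or.inl h1.symm
    · exact Or.inr (Or.inr h1.symm)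
    · exact Or.inr (Or.inl h1)
    · exact Or.inr (Or.inr h1)
  · rintro (rfl | rfl | rfl)
    · exact ⟨(h.succ_ne u).symm, Or.inl (Or.inl rfl)⟩
    · exact ⟨h.succ_ne v, Or.inr (Or.inl rfl)⟩
    · exact ⟨(h.chord_ne u).symm, Or.inl (Or.inr rfl)⟩

theorem succ_ne_pred (v : V) : s v ≠ s.symm v := fun h' => by
  rw [Equiv.eq_symm_apply] at h'
  exact h.succ_succ_ne v h'

theorem pred_ne_chord (v : V) : s.symm v ≠ f v := fun h' => by
  rw [Equiv.symm_apply_eq] at h'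
  exact h.succ_chord_ne v h'.symm

theorem adj_succ (v : V) : (chordGraph s f).Adj v (s v) := h.adj_iff.2 (Or.inl rfl)

theorem isRegularOfDegree [Fintype V] [DecidableEq V] :
    (chordGraph s f).IsRegularOfDegree 3 := by
  intro v
  rw [← card_neighborFinset_eq_degree]
  have : (chordGraph s f).neighborFinset v = {s v, s.symm v, f v} := by
    ext w
    simp [h.adj_iff]
  rw [this, Finset.card_eq_three.2 ⟨_, _, _, h.succ_ne_pred v, (h.chord_ne_succ v).symm,
    h.pred_ne_chord v, rfl⟩]

/-- Removing `x` from the Hamiltonian cycle leaves a path that starts at `s x`. -/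
theorem reachable_succ [Finite V] {S : Finset V} {x : V} (hS : S ⊆ {x}) (hx : s x ∉ S) {v : V}
    (hv : v ∉ S) (hvx : v ≠ x) :
    ((chordGraph s f).induce ((S : Set V)ᶜ)).Reachable ⟨s x, by simpa using hx⟩
      ⟨v, by simpa using hv⟩ := by
  classical
  have key : ∀ k (v : V) (hv : v ∉ S), s^[k + 1] x = v → (∀ i ≤ k, s^[i + 1] x ≠ x) →
      ((chordGraph s f).induce ((S : Set V)ᶜ)).Reachable ⟨s x, by simpa using hx⟩
        ⟨v, by simpa using hv⟩ := by
    intro k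
    induction k with
    | zero =>
      rintro v hv rfl -
      exact Reachable.refl _
    | succ k ih =>
      rintro v hv rfl hne
      have hw : s^[k + 1] x ∉ S := fun hw => hne k (by omega) (by simpa using hS hw)
      refine (ih _ hw rfl fun i hi => hne i (by omega)).trans (Adj.reachable ?_)
      change (chordGraph s f).Adj (s^[k + 1] x) (s^[k + 1 + 1] x)
      rw [Function.iterate_succ_apply' s (k + 1)]
      exact h.adj_succ _
  have hex : ∃ k, s^[k] x = v := by
    obtain ⟨n, hn⟩ := (h.sameCycle x v).exists_nat_pow_eq
    exact ⟨n, by rw [Equiv.Perm.iterate_eq_pow, hn]⟩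
  obtain ⟨k, hk⟩ : ∃ k, Nat.find hex = k + 1 := by
    refine Nat.exists_eq_succ_of_ne_zero fun h0 => hvx ?_
    have := Nat.find_spec hex
    rw [h0] at this
    exact this.symm
  refine key k v hv (by rw [← hk]; exact Nat.find_spec hex) fun i hi hix => ?_
  have h1 := Nat.find_min hex (m := k - i) (by omega)
  apply h1
  have h2 := Nat.find_spec hex
  rwa [hk, show k + 1 = (k - i) + (i + 1) by omega, Function.iterate_add_apply, hix] at h2

theorem isKConnected [Fintype V] [Nonempty V] : IsKConnected 2 (chordGraph s f) := by
  classical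
  obtain ⟨v₀⟩ := ‹Nonempty V›
  refine ⟨Fintype.two_lt_card_iff.2 ⟨v₀, s v₀, f v₀, (h.succ_ne _).symm, (h.chord_ne _).symm,
    (h.chord_ne_succ _).symm⟩, fun S hS => ?_⟩
  obtain ⟨x, hSx⟩ : ∃ x, S ⊆ {x} := by
    rcases Nat.lt_succ_iff.1 hS |>.lt_or_eq with h1 | h1
    · rw [Nat.lt_one_iff, Finset.card_eq_zero] at h1
      exact ⟨v₀, by simp [h1]⟩
    · obtain ⟨x, rfl⟩ := Finset.card_eq_one.1 h1
      exact ⟨x, subset_rfl⟩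
  have hsx : s x ∉ S := fun h1 => h.succ_ne x (by simpa using hSx h1)
  have hall : ∀ v : ((S : Set V)ᶜ : Set V), ((chordGraph s f).induce ((S : Set V)ᶜ)).Reachable
      ⟨s x, by simpa using hsx⟩ v := by
    rintro ⟨v, hv⟩
    by_cases hvx : v = x
    · subst hvx
      exact Adj.reachable (h.adj_succ v).symm
    · exact h.reachable_succ hSx hsx (by simpa using hv) hvx
  have : Nonempty ((S : Set V)ᶜ : Set V) := ⟨⟨s x, by simpa using hsx⟩⟩
  exact ⟨fun u v => (hall u).symm.trans (hall v)⟩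

theorem card_mem_cycleSpectrum [Fintype V] [Nonempty V] :
    Fintype.card V ∈ cycleSpectrum (chordGraph s f) := by
  classical
  obtain ⟨v₀⟩ := ‹Nonempty V›
  have himg : (Finset.range (Function.minimalPeriod s v₀)).image (fun i => s^[i] v₀) =
      Finset.univ := by
    rw [Finset.eq_univ_iff_forall]
    intro v
    obtain ⟨n, hn⟩ := (h.sameCycle v₀ v).exists_nat_pow_eq
    rw [Finset.mem_image]
    refine ⟨n % Function.minimalPeriod s v₀, ?_, ?_⟩
    · exact Finset.mem_range.2 (Nat.mod_lt _ (Function.minimalPeriod_pos_of_mem_periodicPts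
        (s.injective.mem_periodicPts v₀)))
    · rw [← hn, ← Equiv.Perm.iterate_eq_pow]
      exact Function.iterate_mod_minimalPeriod_eq
  have hinj : Set.InjOn (fun i => s^[i] v₀) (Set.Iio (Function.minimalPeriod s v₀)) :=
    Function.iterate_injOn_Iio_minimalPeriod
  have hcard : Function.minimalPeriod s v₀ = Fintype.card V := by
    rw [← Finset.card_univ, ← himg, Finset.card_image_of_injOn (by simpa using hinj),
      Finset.card_range]
  rw [← hcard]
  refine mem_cycleSpectrum_of_sequence (fun i => s^[i] v₀) ?_ (fun i _ => ?_) ?_ hinj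
  · rw [hcard]
    exact Fintype.two_lt_card_iff.2 ⟨v₀, s v₀, f v₀, (h.succ_ne _).symm, (h.chord_ne _).symm,
      (h.chord_ne_succ _).symm⟩
  · simp only [Function.iterate_succ_apply']
    exact h.adj_succ _
  · exact Function.iterate_minimalPeriod

end IsChordData

end Chord

/-! ### Vertices and edges of a cycle -/

section Cycle

variable {V : Type*} {G : SimpleGraph V} {v : V} {c : G.Walk v v}

theorem card_le_length (hc : c.IsCycle) {T : Finset V} (hT : ∀ x ∈ T, x ∈ c.support) :
    T.card ≤ c.length := by
  classical
  have hsub : T ⊆ c.support.tail.toFinset := fun x hx => by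
    rw [List.mem_toFinset]
    rcases (Walk.mem_support_iff c).1 (hT x hx) with rfl | h
    · exact Walk.end_mem_tail_support hc.not_nil
    · exact h
  have := (Finset.card_le_card hsub).trans (List.toFinset_card_le _)
  simpa using this

theorem length_le_card (hc : c.IsCycle) {T : Finset V} (hT : ∀ x ∈ c.support, x ∈ T) :
    c.length ≤ T.card := by
  classical
  have hcard := List.toFinset_card_of_nodup hc.support_nodup
  have hsub : c.support.tail.toFinset ⊆ T := fun x hx =>
    hT x (List.mem_of_mem_tail (List.mem_toFinset.1 hx))
  have := Finset.card_le_card hsub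
  rw [hcard] at this
  simpa using this

theorem le_circumference [Fintype V] {n : ℕ} (hn : n ∈ cycleSpectrum G) :
    n ≤ circumference G := by
  refine le_csSup ⟨Fintype.card V, ?_⟩ hn
  rintro _ ⟨v, c, hc, rfl⟩
  exact length_le_card hc (T := Finset.univ) fun x _ => Finset.mem_univ x

theorem mem_support_of_toSubgraph_adj {x y : V} (h : c.toSubgraph.Adj x y) : x ∈ c.support :=
  c.mem_verts_toSubgraph.1 (c.toSubgraph.edge_vert h)

theorem eq_of_toSubgraph_adj {β : Type*} (g : V → β) {u w : V} (p : G.Walk u w)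
    (h : ∀ x y, p.toSubgraph.Adj x y → g x = g y) : ∀ x ∈ p.support, g x = g u := by
  induction p with
  | nil => simp
  | cons hadj p ih =>
    intro x hx
    rw [Walk.support_cons, List.mem_cons] at hx
    rcases hx with rfl | hx
    · rfl
    · rw [ih (fun x y hxy => h x y (by simp [Walk.toSubgraph, hxy])) x hx]
      exact (h _ _ (by simp [Walk.toSubgraph])).symm

theorem mem_iff_of_ncard {N : Set V} {a b c : V} (hab : a ≠ b) (hac : a ≠ c) (hbc : b ≠ c)
    (hN : N ⊆ {a, b, c}) (h : N.ncard = 2 ∨ N = ∅) : a ∈ N ↔ ¬(b ∈ N ↔ c ∈ N) := by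
  rcases h with h | h
  · obtain ⟨x, y, hxy, rfl⟩ := Set.ncard_eq_two.1 h
    have hx := hN (Set.mem_insert x _)
    have hy := hN (Set.mem_insert_of_mem x rfl)
    simp only [Set.mem_insert_iff, Set.mem_singleton_iff] at hx hy ⊢
    grind
  · simp [h]

/-- A cycle uses an even number of the edges at each vertex. So it uses one of three edges at a
vertex if and only if it uses exactly one of the other two. -/
theorem toSubgraph_adj_iff_not_iff (hc : c.IsCycle) {u x y z : V} (hxy : x ≠ y) (hxz : x ≠ z)
    (hyz : y ≠ z) (hu : ∀ w, G.Adj u w → w = x ∨ w = y ∨ w = z) :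
    c.toSubgraph.Adj u x ↔ ¬(c.toSubgraph.Adj u y ↔ c.toSubgraph.Adj u z) := by
  refine mem_iff_of_ncard (N := c.toSubgraph.neighborSet u) hxy hxz hyz
    (fun w hw => by simpa using hu w (c.toSubgraph.adj_sub hw)) ?_
  by_cases h : u ∈ c.support
  · exact Or.inl (hc.ncard_neighborSet_toSubgraph_eq_two h)
  · right
    rw [Set.eq_empty_iff_forall_notMem]
    exact fun w hw => h (mem_support_of_toSubgraph_adj hw)

end Cycle

/-! ### Straight-line drawings -/

section StraightLine

/-- A straight-line drawing is a planar drawing if its segments meet at most in vertices. The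
relation `E` chooses an orientation of each edge. -/
theorem isPlanar_of_segments {V : Type*} {G : SimpleGraph V} (pos : V → ℝ × ℝ)
    (hinj : Function.Injective pos) (E : V → V → Prop) (hE : ∀ u v, G.Adj u v → E u v ∨ E v u)
    (hvert : ∀ u v w, E u v → pos w ∈ segment ℝ (pos u) (pos v) → w = u ∨ w = v)
    (hedge : ∀ u v x y, E u v → E x y → (u, v) ≠ (x, y) →
      segment ℝ (pos u) (pos v) ∩ segment ℝ (pos x) (pos y) ⊆ Set.range pos) :
    IsPlanar G := by
  have hor : ∀ e ∈ G.edgeSet, ∃ u v, E u v ∧ e = s(u, v) := by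
    intro e he
    induction e using Sym2.ind with
    | _ u v =>
      rcases hE u v he with h | h
      · exact ⟨u, v, h, rfl⟩
      · exact ⟨v, u, h, Sym2.eq_swap⟩
  refine ⟨pos, Sym2.lift ⟨fun u v => segment ℝ (pos u) (pos v), fun u v => segment_symm ℝ _ _⟩,
    hinj, fun u v huv => ?_, fun u v w huv hw => ?_, fun e he f hf hef => ?_⟩
  · refine ⟨1, fun i => if i = 0 then pos u else pos v, one_pos, rfl, rfl, fun i hi => ?_,
      fun i hi => by omega, fun i j hij hj => by omega, ?_⟩
    · obtain rfl : i = 0 := by omega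
      simpa using hinj.ne huv.ne
    · ext x
      simp [Sym2.lift_mk]
  · rcases hE u v huv with h | h
    · exact hvert u v w h hw
    · exact (hvert v u w h (segment_symm ℝ (pos u) _ ▸ hw)).symm
  · obtain ⟨u, v, h, rfl⟩ := hor e he
    obtain ⟨x, y, h', rfl⟩ := hor f hf
    exact hedge u v x y h h' fun h'' => hef (by rw [Prod.mk.injEq] at h''; rw [h''.1, h''.2])

/-- Two segments on different sides of a line, only the second of which may lie on that line,
meet at most in end points of the first. -/
theorem segment_inter_subset_of_line {p q r t : ℝ × ℝ} (α β γ : ℝ)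
    (hp : 0 ≤ α * p.1 + β * p.2 + γ) (hq : 0 ≤ α * q.1 + β * q.2 + γ)
    (hpq : 0 < α * p.1 + β * p.2 + γ ∨ 0 < α * q.1 + β * q.2 + γ)
    (hr : α * r.1 + β * r.2 + γ ≤ 0) (ht : α * t.1 + β * t.2 + γ ≤ 0) :
    segment ℝ p q ∩ segment ℝ r t ⊆ {p, q} := by
  rintro x ⟨⟨a, b, ha, hb, hab, rfl⟩, ⟨a', b', ha', hb', hab', hx⟩⟩
  have h1 := congrArg Prod.fst hx
  have h2 := congrArg Prod.snd hx
  simp only [Prod.fst_add, Prod.snd_add, Prod.smul_fst, Prod.smul_snd, smul_eq_mul] at h1 h2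
  have h3 : a * (α * p.1 + β * p.2 + γ) + b * (α * q.1 + β * q.2 + γ) =
      a' * (α * r.1 + β * r.2 + γ) + b' * (α * t.1 + β * t.2 + γ) := by
    linear_combination -α * h1 - β * h2 + γ * hab - γ * hab'
  have h4 := mul_nonneg ha hp
  have h5 := mul_nonneg hb hq
  have h6 := mul_nonpos_of_nonneg_of_nonpos ha' hr
  have h7 := mul_nonpos_of_nonneg_of_nonpos hb' ht
  rcases hpq with h | h
  · have : a = 0 := by
      rcases mul_eq_zero.1 (show a * (α * p.1 + β * p.2 + γ) = 0 by linarith) with h8 | h8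
      · exact h8
      · exact absurd h8 h.ne'
    subst this
    obtain rfl : b = 1 := by linarith
    simp
  · have : b = 0 := by
      rcases mul_eq_zero.1 (show b * (α * q.1 + β * q.2 + γ) = 0 by linarith) with h8 | h8
      · exact h8
      · exact absurd h8 h.ne'
    subst this
    obtain rfl : a = 1 := by linarith
    simp

end StraightLine

/-! ### Straight-line drawings with natural number coordinates -/

section Coordinates

/-- The point `r` lies strictly to the left of the directed line from `p` to `q`. The two sides of
the determinant inequality are kept free of subtraction, so that they are evaluated quickly. -/
def isLeft (p q r : ℕ × ℕ) : Bool :=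
  Nat.blt (p.2 * q.1 + q.2 * r.1 + r.2 * p.1) (p.1 * q.2 + q.1 * r.2 + r.1 * p.2)

/-- The segment from `r` to `t` lies weakly to the left of the directed line from `p` to `q`, and
is not contained in it. -/
def onLeft (p q r t : ℕ × ℕ) : Bool :=
  !isLeft q p r && !isLeft q p t && (isLeft p q r || isLeft p q t)

/-- One of the segments `p q`, `r t` lies on one side of the line through the other one and is not
contained in that line. -/
def sideBySide (p q r t : ℕ × ℕ) : Bool :=
  onLeft p q r t || onLeft q p r t || onLeft r t p q || onLeft t r p q

/-- The point of the real plane with the given coordinates. -/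
def toPlane (p : ℕ × ℕ) : ℝ × ℝ := (p.1, p.2)

theorem toPlane_injective : Function.Injective toPlane := by
  rintro ⟨a, b⟩ ⟨c, d⟩ h
  simpa [toPlane] using h

/-- Twice the signed area of the triangle `p q x`, as an affine function of `x`. -/
theorem isLeft_iff (p q x : ℕ × ℕ) : isLeft p q x = true ↔
    0 < -((q.2 : ℝ) - p.2) * (toPlane x).1 + ((q.1 : ℝ) - p.1) * (toPlane x).2 +
      (((q.2 : ℝ) - p.2) * p.1 - ((q.1 : ℝ) - p.1) * p.2) := by
  rw [isLeft, Nat.blt_eq, ← Nat.cast_lt (α := ℝ), ← sub_pos]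
  simp only [toPlane]
  push_cast
  ring_nf

theorem isLeft_swap_iff (p q x : ℕ × ℕ) : isLeft q p x = true ↔
    -((q.2 : ℝ) - p.2) * (toPlane x).1 + ((q.1 : ℝ) - p.1) * (toPlane x).2 +
      (((q.2 : ℝ) - p.2) * p.1 - ((q.1 : ℝ) - p.1) * p.2) < 0 := by
  rw [isLeft_iff, ← neg_pos]
  ring_nf

theorem toPlane_notMem_segment {p q r : ℕ × ℕ} (h : isLeft p q r = true) :
    toPlane r ∉ segment ℝ (toPlane p) (toPlane q) := by
  rintro ⟨a, b, ha, hb, hab, hx⟩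
  rw [isLeft_iff, ← hx] at h
  obtain rfl : a = 1 - b := by linarith
  simp only [toPlane, Prod.fst_add, Prod.snd_add, Prod.smul_fst, Prod.smul_snd, smul_eq_mul] at h
  ring_nf at h
  exact lt_irrefl _ h

theorem segment_inter_subset_of_onLeft {p q r t : ℕ × ℕ} (h : onLeft p q r t = true) :
    segment ℝ (toPlane r) (toPlane t) ∩ segment ℝ (toPlane p) (toPlane q) ⊆
      {toPlane r, toPlane t} := by
  have hp : ∀ p q : ℕ × ℕ, ¬ isLeft p q p = true := fun p q => by
    rw [isLeft_iff]; simp only [toPlane]; ring_nf; simp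
  have hq : ∀ p q : ℕ × ℕ, ¬ isLeft p q q = true := fun p q => by
    rw [isLeft_iff]; simp only [toPlane]; ring_nf; simp
  have hp' := hp p q
  have hq' := hq p q
  simp only [onLeft, Bool.and_eq_true, Bool.not_eq_true', Bool.or_eq_true, ← Bool.not_eq_true,
    isLeft_swap_iff p q, isLeft_iff p q, not_lt] at h hp' hq'
  exact segment_inter_subset_of_line _ _ _ h.1.1 h.1.2 h.2 hp' hq'

theorem subset_of_sideBySide {p q r t : ℕ × ℕ} (h : sideBySide p q r t = true) :
    segment ℝ (toPlane p) (toPlane q) ∩ segment ℝ (toPlane r) (toPlane t) ⊆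
      {toPlane p, toPlane q} ∪ {toPlane r, toPlane t} := by
  simp only [sideBySide, Bool.or_eq_true] at h
  rcases h with ((h | h) | h) | h
  · rw [Set.inter_comm]
    exact (segment_inter_subset_of_onLeft h).trans Set.subset_union_right
  · rw [Set.inter_comm, segment_symm ℝ (toPlane p)]
    exact (segment_inter_subset_of_onLeft h).trans Set.subset_union_right
  · exact (segment_inter_subset_of_onLeft h).trans Set.subset_union_left
  · rw [segment_symm ℝ (toPlane r)]
    exact (segment_inter_subset_of_onLeft h).trans Set.subset_union_left

/-- The segments of the list `L` meet at most in end points. -/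
def segmentsAdmissible (L : List ((ℕ × ℕ) × (ℕ × ℕ))) : Bool :=
  L.all fun e => L.all fun e' => sideBySide e.1 e.2 e'.1 e'.2 || e == e'

/-- The points of the list `Q` lie on segments of the list `L` only as end points. -/
def pointsAdmissible (L : List ((ℕ × ℕ) × (ℕ × ℕ))) (Q : List (ℕ × ℕ)) : Bool :=
  L.all fun e => Q.all fun x => isLeft e.1 e.2 x || isLeft e.2 e.1 x || x == e.1 || x == e.2

/-- A straight-line drawing of a Hamiltonian cubic graph with vertices in the list `Q` and edges in
the list `L`. All hypotheses can be checked by evaluation. -/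
theorem isPlanar_chordGraph {V : Type*} {s : Equiv.Perm V} {f : V → V} (P : V → ℕ × ℕ)
    (hinj : Function.Injective P) (L : List ((ℕ × ℕ) × (ℕ × ℕ))) (Q : List (ℕ × ℕ))
    (hQ : ∀ v, P v ∈ Q) (hs : ∀ u, (P u, P (s u)) ∈ L ∨ (P (s u), P u) ∈ L)
    (hf : ∀ u, (P u, P (f u)) ∈ L ∨ (P (f u), P u) ∈ L)
    (hLQ : pointsAdmissible L Q = true) (hLL : segmentsAdmissible L = true) :
    IsPlanar (chordGraph s f) := by
  simp only [pointsAdmissible, segmentsAdmissible, List.all_eq_true, Bool.or_eq_true, beq_iff_eq]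
    at hLQ hLL
  refine isPlanar_of_segments (fun v => toPlane (P v)) (toPlane_injective.comp hinj)
    (fun u v => (P u, P v) ∈ L) (chordGraph_orientation hs hf) ?_ ?_
  · intro u v w hv hw
    rcases hLQ _ hv _ (hQ w) with ((h | h) | h) | h
    · exact absurd hw (toPlane_notMem_segment h)
    · exact absurd hw (segment_symm ℝ (toPlane (P v)) _ ▸ toPlane_notMem_segment h)
    · exact Or.inl (hinj h)
    · exact Or.inr (hinj h)
  · intro u v x y hv hy hne
    rcases hLL _ hv _ hy with h | h
    · refine (subset_of_sideBySide h).trans ?_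
      rintro z ((rfl | rfl) | (rfl | rfl)) <;> exact ⟨_, rfl⟩
    · rw [Prod.mk.injEq] at h
      exact absurd (Prod.ext (hinj h.1) (hinj h.2)) hne

end Coordinates

/-! ### Rings of blocks -/

section Block

variable {m k : ℕ} [NeZero m] [NeZero k]

/-- The cyclic permutation of `m` blocks of `k` vertices. -/
def blockSucc (m k : ℕ) [NeZero m] [NeZero k] : Equiv.Perm (Fin m × Fin k) where
  toFun v := (if v.2 + 1 = 0 then v.1 + 1 else v.1, v.2 + 1)
  invFun v := (if v.2 = 0 then v.1 - 1 else v.1, v.2 - 1)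
  left_inv v := by
    ext1
    · by_cases h : v.2 + 1 = 0 <;> simp [h]
    · simp
  right_inv v := by
    ext1
    · by_cases h : v.2 = 0 <;> simp [h]
    · simp

theorem blockSucc_sameCycle (u v : Fin m × Fin k) : (blockSucc m k).SameCycle u v := by
  have hstep : ∀ w, (blockSucc m k).SameCycle ((blockSucc m k).symm w) w := fun w => ⟨1, by simp⟩
  have hblock : ∀ (h : Fin m) (n : ℕ) (i : Fin k), i.val = n →
      (blockSucc m k).SameCycle (h, 0) (h, i) := by
    intro h n
    induction n with
    | zero =>
      intro i hi
      rw [Fin.val_eq_zero_iff] at hi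
      rw [hi]
    | succ n ih =>
      intro i hi
      have hi0 : i ≠ 0 := by rintro rfl; simp at hi
      have h1 := hstep (h, i)
      simp only [blockSucc, Equiv.coe_fn_symm_mk, if_neg hi0] at h1
      exact (ih (i - 1) (by rw [Fin.val_sub_one_of_ne_zero hi0]; omega)).trans h1
  have hring : ∀ (n : ℕ) (h : Fin m), h.val = n → (blockSucc m k).SameCycle (0, 0) (h, 0) := by
    intro n
    induction n with
    | zero =>
      intro h hn
      rw [Fin.val_eq_zero_iff] at hn
      rw [hn]
    | succ n ih =>
      intro h hn
      have hh0 : h ≠ 0 := by rintro rfl; simp at hn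
      have h1 := hstep (h, 0)
      simp only [blockSucc, Equiv.coe_fn_symm_mk, if_true] at h1
      exact (ih (h - 1) (by rw [Fin.val_sub_one_of_ne_zero hh0]; omega)).trans
        ((hblock _ _ _ rfl).trans h1)
  have hall : ∀ w : Fin m × Fin k, (blockSucc m k).SameCycle (0, 0) w := fun w =>
    (hring _ w.1 rfl).trans (hblock _ _ _ rfl)
  exact (hall u).symm.trans (hall v)

end Block

/-! ### The dodecahedron and the truncated dodecahedron -/

section Dodecahedron

/-- The chords of a Hamiltonian cycle of the dodecahedron. -/
def dodecaChord (v : Fin 20) : Fin 20 :=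
  v + [10, 7, 4, -4, -7, 10, -4, 7, -7, 4].getD (v.1 % 10) 0

/-- The vertices of a straight-line drawing of the dodecahedron. -/
def dodecaPoints : List (ℕ × ℕ) := [
    (58, 31), (34, 58), (0, 44), (4, 7), (15, 18), (17, 27), (14, 36), (23, 37),
    (30, 43), (34, 35), (43, 30), (35, 23), (31, 26), (30, 31), (25, 32), (23, 28),
    (26, 24), (25, 18), (33, 14), (39, 0)]

/-- The edges of a straight-line drawing of the dodecahedron. -/
def dodecaSegments : List ((ℕ × ℕ) × (ℕ × ℕ)) := [
    ((58, 31), (34, 58)), ((34, 58), (0, 44)), ((0, 44), (4, 7)), ((4, 7), (15, 18)),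
    ((15, 18), (17, 27)), ((17, 27), (14, 36)), ((14, 36), (23, 37)), ((23, 37), (30, 43)),
    ((30, 43), (34, 35)), ((34, 35), (43, 30)), ((43, 30), (35, 23)), ((35, 23), (31, 26)),
    ((31, 26), (30, 31)), ((30, 31), (25, 32)), ((25, 32), (23, 28)), ((23, 28), (26, 24)),
    ((26, 24), (25, 18)), ((25, 18), (33, 14)), ((33, 14), (39, 0)), ((39, 0), (58, 31)),
    ((58, 31), (43, 30)), ((34, 58), (30, 43)), ((0, 44), (14, 36)), ((4, 7), (39, 0)),
    ((15, 18), (25, 18)), ((17, 27), (23, 28)), ((23, 37), (25, 32)), ((34, 35), (30, 31)),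
    ((35, 23), (33, 14)), ((31, 26), (26, 24))]

/-- The chords of a Hamiltonian cycle of the truncated dodecahedron that runs through all three
vertices of each triangle: the vertices `(v, 0)`, `(v, 1)`, `(v, 2)` lie on the edges from `v` to
`v - 1`, `dodecaChord v` and `v + 1`, respectively. -/
def truncChord (v : Fin 20 × Fin 3) : Fin 20 × Fin 3 :=
  if v.2 = 1 then (dodecaChord v.1, 1) else (v.1, 2 - v.2)

/-- The vertices of a straight-line drawing of the truncated dodecahedron. -/
def truncPoints : List (ℕ × ℕ) := [
    (207, 96), (199, 114), (203, 133), (141, 203), (121, 201), (104, 211), (19, 173), (14, 154),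
    (0, 141), (9, 48), (34, 20), (26, 38), (41, 51), (68, 65), (58, 76), (60, 88),
    (70, 101), (58, 112), (53, 123), (31, 144), (60, 136), (73, 137), (88, 132), (94, 146),
    (103, 155), (117, 182), (118, 151), (123, 140), (123, 124), (139, 123), (149, 116), (179, 112),
    (151, 102), (142, 93), (130, 73), (126, 89), (120, 92), (108, 94), (113, 102), (112, 108),
    (117, 119), (106, 116), (100, 117), (91, 125), (91, 113), (87, 108), (77, 102), (88, 98),
    (93, 93), (102, 91), (95, 81), (94, 74), (80, 66), (103, 61), (113, 55), (127, 61),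
    (132, 31), (140, 13), (125, 0), (160, 15)]

/-- The edges of a straight-line drawing of the truncated dodecahedron. -/
def truncSegments : List ((ℕ × ℕ) × (ℕ × ℕ)) := [
    ((207, 96), (199, 114)), ((199, 114), (203, 133)), ((203, 133), (141, 203)),
    ((141, 203), (121, 201)), ((121, 201), (104, 211)), ((104, 211), (19, 173)),
    ((19, 173), (14, 154)), ((14, 154), (0, 141)), ((0, 141), (9, 48)),
    ((9, 48), (34, 20)), ((34, 20), (26, 38)), ((26, 38), (41, 51)),
    ((41, 51), (68, 65)), ((68, 65), (58, 76)), ((58, 76), (60, 88)),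
    ((60, 88), (70, 101)), ((70, 101), (58, 112)), ((58, 112), (53, 123)),
    ((53, 123), (31, 144)), ((31, 144), (60, 136)), ((60, 136), (73, 137)),
    ((73, 137), (88, 132)), ((88, 132), (94, 146)), ((94, 146), (103, 155)),
    ((103, 155), (117, 182)), ((117, 182), (118, 151)), ((118, 151), (123, 140)),
    ((123, 140), (123, 124)), ((123, 124), (139, 123)), ((139, 123), (149, 116)),
    ((149, 116), (179, 112)), ((179, 112), (151, 102)), ((151, 102), (142, 93)),
    ((142, 93), (130, 73)), ((130, 73), (126, 89)), ((126, 89), (120, 92)),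
    ((120, 92), (108, 94)), ((108, 94), (113, 102)), ((113, 102), (112, 108)),
    ((112, 108), (117, 119)), ((117, 119), (106, 116)), ((106, 116), (100, 117)),
    ((100, 117), (91, 125)), ((91, 125), (91, 113)), ((91, 113), (87, 108)),
    ((87, 108), (77, 102)), ((77, 102), (88, 98)), ((88, 98), (93, 93)),
    ((93, 93), (102, 91)), ((102, 91), (95, 81)), ((95, 81), (94, 74)),
    ((94, 74), (80, 66)), ((80, 66), (103, 61)), ((103, 61), (113, 55)),
    ((113, 55), (127, 61)), ((127, 61), (132, 31)), ((132, 31), (140, 13)),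
    ((140, 13), (125, 0)), ((125, 0), (160, 15)), ((160, 15), (207, 96)),
    ((207, 96), (203, 133)), ((199, 114), (179, 112)), ((141, 203), (104, 211)),
    ((121, 201), (117, 182)), ((19, 173), (0, 141)), ((14, 154), (31, 144)),
    ((9, 48), (26, 38)), ((34, 20), (125, 0)), ((41, 51), (58, 76)),
    ((68, 65), (80, 66)), ((60, 88), (58, 112)), ((70, 101), (77, 102)),
    ((53, 123), (60, 136)), ((73, 137), (94, 146)), ((88, 132), (91, 125)),
    ((103, 155), (118, 151)), ((123, 140), (139, 123)), ((123, 124), (117, 119)),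
    ((149, 116), (151, 102)), ((142, 93), (126, 89)), ((130, 73), (127, 61)),
    ((120, 92), (113, 102)), ((108, 94), (102, 91)), ((112, 108), (106, 116)),
    ((100, 117), (91, 113)), ((87, 108), (88, 98)), ((93, 93), (95, 81)),
    ((94, 74), (103, 61)), ((113, 55), (132, 31)), ((140, 13), (160, 15))]

/-- The dodecahedron. -/
abbrev dodecahedron : SimpleGraph (Fin 20) := chordGraph (finRotate 20) dodecaChord

/-- The truncated dodecahedron. -/
abbrev truncDodecahedron : SimpleGraph (Fin 20 × Fin 3) := chordGraph (blockSucc 20 3) truncChord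

theorem dodeca_isChordData : IsChordData (finRotate 20) dodecaChord where
  invol := by decide
  succ_ne := by decide
  succ_succ_ne := by decide
  chord_ne := by decide
  chord_ne_succ := by decide
  succ_chord_ne := by decide
  sameCycle u v := by
    have h : ∀ w, finRotate 20 w ≠ w := by decide
    exact isCycle_finRotate.sameCycle (h u) (h v)

theorem trunc_isChordData : IsChordData (blockSucc 20 3) truncChord where
  invol := by decide
  succ_ne := by decide
  succ_succ_ne := by decide
  chord_ne := by decide
  chord_ne_succ := by decide
  succ_chord_ne := by decide
  sameCycle := blockSucc_sameCycle

theorem isPlanar_dodecahedron : IsPlanar dodecahedron :=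
  isPlanar_chordGraph (fun v => dodecaPoints.getD v.1 (0, 0))
    (by unfold Function.Injective; decide +kernel) dodecaSegments dodecaPoints
    (by decide +kernel) (by decide +kernel) (by decide +kernel) (by decide +kernel)
    (by decide +kernel)

theorem isPlanar_truncDodecahedron : IsPlanar truncDodecahedron :=
  isPlanar_chordGraph (fun v => truncPoints.getD (3 * v.1.1 + v.2.1) (0, 0))
    (by unfold Function.Injective; decide +kernel) truncSegments truncPoints
    (by decide +kernel) (by decide +kernel) (by decide +kernel) (by decide +kernel)
    (by decide +kernel)

end Dodecahedron

/-! ### Cycles in the dodecahedron and the truncated dodecahedron -/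

section DodecahedronCycles

/-- The three neighbours of a vertex of the dodecahedron. -/
def dodecaNbr (v : Fin 20) (i : Fin 3) : Fin 20 := ![v - 1, dodecaChord v, v + 1] i

theorem dodecaNbr_injective (v : Fin 20) {i j : Fin 3} (hij : i ≠ j) :
    dodecaNbr v i ≠ dodecaNbr v j := by
  revert v i j
  decide +kernel

/-- The dodecahedron has girth at least five. -/
theorem dodeca_nodup (v : Fin 20) {i j : Fin 3} (hij : i ≠ j) (k l : Fin 3)
    (hk : dodecaNbr (dodecaNbr v i) k ≠ v) (hl : dodecaNbr (dodecaNbr v j) l ≠ v) :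
    [v, dodecaNbr v i, dodecaNbr v j, dodecaNbr (dodecaNbr v i) k,
      dodecaNbr (dodecaNbr v j) l].Nodup := by
  revert v i j k l
  decide +kernel

/-- A nonempty set of vertices of the dodecahedron that induces minimum degree at least two has at
least five elements. -/
theorem five_le_card {S : Finset (Fin 20)} (hne : S.Nonempty)
    (h : ∀ v ∈ S, ∃ i j, i ≠ j ∧ dodecaNbr v i ∈ S ∧ dodecaNbr v j ∈ S) : 5 ≤ S.card := by
  obtain ⟨v, hv⟩ := hne
  have hother : ∀ x ∈ S, ∃ k, dodecaNbr x k ∈ S ∧ dodecaNbr x k ≠ v := by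
    intro x hx
    obtain ⟨i, j, hij, hi, hj⟩ := h x hx
    by_cases hiv : dodecaNbr x i = v
    · exact ⟨j, hj, fun hjv => dodecaNbr_injective x hij (hiv.trans hjv.symm)⟩
    · exact ⟨i, hi, hiv⟩
  obtain ⟨i, j, hij, hi, hj⟩ := h v hv
  obtain ⟨k, hk, hkv⟩ := hother _ hi
  obtain ⟨l, hl, hlv⟩ := hother _ hj
  refine (List.toFinset_card_of_nodup (dodeca_nodup v hij k l hkv hlv)).ge.trans
    (Finset.card_le_card fun x hx => ?_)
  simp only [List.mem_toFinset, List.mem_cons, List.not_mem_nil, or_false] at hx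
  rcases hx with rfl | rfl | rfl | rfl | rfl <;> assumption

theorem dodeca_adj (v w : Fin 20) (h : dodecahedron.Adj v w) : ∃ i, w = dodecaNbr v i := by
  revert v w
  decide +kernel

theorem five_le_of_mem_cycleSpectrum_dodecahedron {n : ℕ} (hn : n ∈ cycleSpectrum dodecahedron) :
    5 ≤ n := by
  obtain ⟨v, c, hc, rfl⟩ := hn
  refine (five_le_card (S := c.support.toFinset) ⟨v, by simp⟩ ?_).trans
    (card_le_length hc fun x hx => by simpa using hx)
  intro x hx
  obtain ⟨y, z, hyz, hN⟩ := Set.ncard_eq_two.1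
    (hc.ncard_neighborSet_toSubgraph_eq_two (List.mem_toFinset.1 hx))
  have hy : c.toSubgraph.Adj x y := by
    rw [← Subgraph.mem_neighborSet, hN]; simp
  have hz : c.toSubgraph.Adj x z := by
    rw [← Subgraph.mem_neighborSet, hN]; simp
  obtain ⟨i, rfl⟩ := dodeca_adj x y (c.toSubgraph.adj_sub hy)
  obtain ⟨j, rfl⟩ := dodeca_adj x z (c.toSubgraph.adj_sub hz)
  refine ⟨i, j, ?_, ?_, ?_⟩
  · rintro rfl; exact hyz rfl
  · exact List.mem_toFinset.2 (mem_support_of_toSubgraph_adj hy.symm)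
  · exact List.mem_toFinset.2 (mem_support_of_toSubgraph_adj hz.symm)

/-- The neighbour of `(v, i)` outside its triangle. -/
def truncCross (v : Fin 20) (i : Fin 3) : Fin 20 × Fin 3 := (dodecaNbr v i, 2 - i)

theorem truncCross_truncCross (v : Fin 20) (i : Fin 3) :
    truncCross (dodecaNbr v i) (2 - i) = (v, i) := by
  revert v i
  decide +kernel

theorem truncCross_ne (v : Fin 20) (i j : Fin 3) : truncCross v i ≠ (v, j) := by
  revert v i j
  decide +kernel

theorem trunc_adj (v : Fin 20) (i : Fin 3) (w : Fin 20 × Fin 3)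
    (h : truncDodecahedron.Adj (v, i) w) :
    w = truncCross v i ∨ w = (v, i + 1) ∨ w = (v, i + 2) := by
  revert v i w
  decide +kernel

/-- A cycle that leaves a triangle of the truncated dodecahedron visits at least two vertices of
each triangle that it meets, and the set of these triangles has minimum degree at least two in the
dodecahedron. -/
theorem le_or_le_of_mem_cycleSpectrum_truncDodecahedron {n : ℕ}
    (hn : n ∈ cycleSpectrum truncDodecahedron) : n ≤ 3 ∨ 10 ≤ n := by
  classical
  obtain ⟨u, c, hc, rfl⟩ := hn
  set A := c.toSubgraph.Adj with hA
  have hpar : ∀ v i, A (v, i) (truncCross v i) ↔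
      ¬(A (v, i) (v, i + 1) ↔ A (v, i) (v, i + 2)) := fun v i =>
    toSubgraph_adj_iff_not_iff hc (truncCross_ne v i _) (truncCross_ne v i _)
      (by simp) (trunc_adj v i)
  have hcomm : ∀ x y, A x y ↔ A y x := fun x y => c.toSubgraph.adj_comm x y
  have htwo : ∀ v i, A (v, i) (truncCross v i) → ∃ j, i ≠ j ∧ A (v, j) (truncCross v j) := by
    intro v i hi
    have h0 := hpar v 0
    have h1 := hpar v 1
    have h2 := hpar v 2
    simp only [Fin.isValue, show (0 : Fin 3) + 1 = 1 from rfl, show (0 : Fin 3) + 2 = 2 from rfl,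
      show (1 : Fin 3) + 1 = 2 from rfl, show (1 : Fin 3) + 2 = 0 from rfl,
      show (2 : Fin 3) + 1 = 0 from rfl, show (2 : Fin 3) + 2 = 1 from rfl, hcomm (v, 1) (v, 0),
      hcomm (v, 2) (v, 0), hcomm (v, 2) (v, 1)] at h0 h1 h2
    have h012 : ∀ i : Fin 3, i = 0 ∨ i = 1 ∨ i = 2 := by decide
    rcases h012 i with rfl | rfl | rfl
    · by_cases h : A (v, 1) (truncCross v 1)
      · exact ⟨1, by decide, h⟩
      · exact ⟨2, by decide, by tauto⟩
    · by_cases h : A (v, 0) (truncCross v 0)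
      · exact ⟨0, by decide, h⟩
      · exact ⟨2, by decide, by tauto⟩
    · by_cases h : A (v, 0) (truncCross v 0)
      · exact ⟨0, by decide, h⟩
      · exact ⟨1, by decide, by tauto⟩
  set S : Finset (Fin 20) := Finset.univ.filter fun v => ∃ i, A (v, i) (truncCross v i) with hS
  have hmemS : ∀ v i, A (v, i) (truncCross v i) → dodecaNbr v i ∈ S := by
    intro v i h
    rw [hS, Finset.mem_filter]
    refine ⟨Finset.mem_univ _, 2 - i, ?_⟩
    rw [truncCross_truncCross, hcomm]
    exact h
  by_cases hne : S.Nonempty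
  · right
    have h5 : 5 ≤ S.card := by
      refine five_le_card hne fun v hv => ?_
      obtain ⟨i, hi⟩ := (Finset.mem_filter.1 hv).2
      obtain ⟨j, hij, hj⟩ := htwo v i hi
      exact ⟨i, j, hij, hmemS v i hi, hmemS v j hj⟩
    set T : Finset (Fin 20 × Fin 3) :=
      Finset.univ.filter fun x => A x (truncCross x.1 x.2) with hT
    have hTS : S.card * 2 ≤ T.card := by
      rw [Finset.card_eq_sum_card_fiberwise (s := T) (f := Prod.fst) (t := S), ← smul_eq_mul]
      · refine Finset.card_nsmul_le_sum _ _ _ fun v hv => ?_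
        obtain ⟨i, hi⟩ := (Finset.mem_filter.1 hv).2
        obtain ⟨j, hij, hj⟩ := htwo v i hi
        rw [← Finset.card_pair (a := ((v, i) : Fin 20 × Fin 3)) (b := (v, j)) (by simpa using hij)]
        refine Finset.card_le_card fun x hx => ?_
        simp only [Finset.mem_insert, Finset.mem_singleton] at hx
        rcases hx with rfl | rfl
        · exact Finset.mem_filter.2 ⟨Finset.mem_filter.2 ⟨Finset.mem_univ _, hi⟩, rfl⟩
        · exact Finset.mem_filter.2 ⟨Finset.mem_filter.2 ⟨Finset.mem_univ _, hj⟩, rfl⟩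
      · intro x hx
        have hx' := (Finset.mem_filter.1 hx).2
        simp only [hS, Finset.coe_filter, Finset.mem_univ, true_and, Set.mem_ofPred_eq]
        exact ⟨x.2, hx'⟩
    have := card_le_length hc (T := T) fun x hx =>
      mem_support_of_toSubgraph_adj (Finset.mem_filter.1 hx).2
    omega
  · left
    have hno : ∀ v i, ¬A (v, i) (truncCross v i) := fun v i h =>
      hne ⟨v, by simp only [hS, Finset.mem_filter, Finset.mem_univ, true_and]; exact ⟨i, h⟩⟩
    have hfst := eq_of_toSubgraph_adj Prod.fst c (by
      rintro ⟨v, i⟩ y hxy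
      rcases trunc_adj v i y (c.toSubgraph.adj_sub hxy) with rfl | rfl | rfl
      · exact absurd hxy (hno v i)
      · rfl
      · rfl)
    have := length_le_card hc (T := {u.1} ×ˢ Finset.univ) fun x hx =>
      Finset.mem_product.2 ⟨Finset.mem_singleton.2 (hfst x hx), Finset.mem_univ _⟩
    simpa using this

end DodecahedronCycles

/-! ### Necklaces of diamonds -/

section Necklace

variable {m : ℕ} [NeZero m]

/-- The chords of a Hamiltonian cycle in a cyclic necklace of `m` diamonds. -/
def necklaceChord (v : Fin m × Fin 4) : Fin m × Fin 4 := (v.1, v.2 + 2)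

/-- The necklace: `m` copies of `K₄` minus an edge, whose vertices of degree two are linked
cyclically. -/
abbrev necklace (m : ℕ) [NeZero m] : SimpleGraph (Fin m × Fin 4) :=
  chordGraph (blockSucc m 4) necklaceChord

theorem necklace_isChordData : IsChordData (blockSucc m 4) necklaceChord := by
  have h1 : ∀ i : Fin 4, i + 2 + 2 = i := by decide
  have h2 : ∀ i : Fin 4, i + 1 ≠ i := by decide
  have h3 : ∀ i : Fin 4, i + 1 + 1 ≠ i := by decide
  have h4 : ∀ i : Fin 4, i + 2 ≠ i := by decide
  have h5 : ∀ i : Fin 4, i + 2 ≠ i + 1 := by decide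
  have h6 : ∀ i : Fin 4, i + 2 + 1 ≠ i := by decide
  exact ⟨fun v => Prod.ext rfl (h1 v.2), fun v h => h2 _ (congrArg Prod.snd h),
    fun v h => h3 _ (congrArg Prod.snd h), fun v h => h4 _ (congrArg Prod.snd h),
    fun v h => h5 _ (congrArg Prod.snd h), fun v h => h6 _ (congrArg Prod.snd h),
    blockSucc_sameCycle⟩

theorem iff_of_parity {a b c d e l r : Prop} (ha : a ↔ ¬(l ↔ d)) (hb : b ↔ ¬(a ↔ e))
    (hc : c ↔ ¬(b ↔ d)) (hr : r ↔ ¬(c ↔ e)) : l ↔ r := by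
  by_cases l <;> by_cases d <;> by_cases e <;> simp_all

/-- By parity at the four vertices of a diamond, a cycle that enters the diamond by one link also
uses the other one. So a cycle stays in one diamond or visits all of them. -/
theorem le_or_le_of_mem_cycleSpectrum_necklace {n : ℕ} (hn : n ∈ cycleSpectrum (necklace m)) :
    n ≤ 4 ∨ m ≤ n := by
  classical
  obtain ⟨u, c, hc, rfl⟩ := hn
  set A := c.toSubgraph.Adj with hA
  have hd := necklace_isChordData (m := m)
  have hpar : ∀ x, A x (blockSucc m 4 x) ↔
      ¬(A x ((blockSucc m 4).symm x) ↔ A x (necklaceChord x)) := fun x =>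
    toSubgraph_adj_iff_not_iff hc (hd.succ_ne_pred x) (hd.chord_ne_succ x).symm
      (hd.pred_ne_chord x) fun w hw => hd.adj_iff.1 hw
  have hcomm : ∀ x y, A x y ↔ A y x := fun x y => c.toSubgraph.adj_comm x y
  have hlink : ∀ j, A (j, 0) (j - 1, 3) ↔ A (j, 3) (j + 1, 0) := by
    intro j
    have h0 := hpar (j, 0)
    have h1 := hpar (j, 1)
    have h2 := hpar (j, 2)
    have h3 := hpar (j, 3)
    simp only [blockSucc, necklaceChord, Equiv.coe_fn_mk, Equiv.coe_fn_symm_mk, Fin.isValue,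
      show (0 : Fin 4) + 1 = 1 from rfl, show (1 : Fin 4) + 1 = 2 from rfl,
      show (2 : Fin 4) + 1 = 3 from rfl, show (3 : Fin 4) + 1 = 0 from rfl,
      show (0 : Fin 4) - 1 = 3 from rfl, show (1 : Fin 4) - 1 = 0 from rfl,
      show (2 : Fin 4) - 1 = 1 from rfl, show (3 : Fin 4) - 1 = 2 from rfl,
      show (0 : Fin 4) + 2 = 2 from rfl, show (1 : Fin 4) + 2 = 3 from rfl,
      show (2 : Fin 4) + 2 = 0 from rfl, show (3 : Fin 4) + 2 = 1 from rfl,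
      show (1 : Fin 4) ≠ 0 by decide, show (2 : Fin 4) ≠ 0 by decide,
      show (3 : Fin 4) ≠ 0 by decide, if_true, if_false] at h0 h1 h2 h3
    rw [hcomm (j, 1) (j, 0)] at h1
    rw [hcomm (j, 2) (j, 1), hcomm (j, 2) (j, 0)] at h2
    rw [hcomm (j, 3) (j, 2), hcomm (j, 3) (j, 1)] at h3
    exact iff_of_parity h0 h1 h2 h3
  have hall : ∀ (k : ℕ) (j : Fin m), j.val = k → (A (j, 0) (j - 1, 3) ↔ A (0, 0) (0 - 1, 3)) := by
    intro k
    induction k with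
    | zero =>
      intro j hj
      rw [Fin.val_eq_zero_iff] at hj
      rw [hj]
    | succ k ih =>
      intro j hj
      have hj0 : j ≠ 0 := by rintro rfl; simp at hj
      rw [← ih (j - 1) (by rw [Fin.val_sub_one_of_ne_zero hj0]; omega), hlink (j - 1),
        hcomm (j - 1, 3), sub_add_cancel]
  by_cases h0 : A (0, 0) (0 - 1, 3)
  · right
    have hmem : ∀ j : Fin m, (j, (0 : Fin 4)) ∈ c.support := fun j =>
      mem_support_of_toSubgraph_adj ((hall _ j rfl).2 h0)
    have hinj : Function.Injective fun j : Fin m => (j, (0 : Fin 4)) := fun a b h =>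
      congrArg Prod.fst h
    have := card_le_length hc (T := Finset.univ.image fun j : Fin m => (j, (0 : Fin 4)))
      fun x hx => by
        obtain ⟨j, -, rfl⟩ := Finset.mem_image.1 hx
        exact hmem j
    rw [Finset.card_image_of_injective _ hinj] at this
    simpa using this
  · left
    have hin : ∀ j, ¬A (j, 0) (j - 1, 3) := fun j h => h0 ((hall _ j rfl).1 h)
    have h4 : ∀ i : Fin 4, i + 1 = 0 → i = 3 := by decide
    have hfst := eq_of_toSubgraph_adj Prod.fst c (by
      rintro ⟨j, i⟩ y hxy
      rcases hd.adj_iff.1 (c.toSubgraph.adj_sub hxy) with rfl | rfl | rfl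
      · by_cases hi : i + 1 = 0
        · obtain rfl := h4 i hi
          exact absurd ((hlink j).2 hxy) (hin j)
        · simp [blockSucc, hi]
      · by_cases hi : i = 0
        · subst hi
          exact absurd hxy (hin j)
        · simp [blockSucc, hi]
      · rfl)
    have := length_le_card hc (T := {u.1} ×ˢ Finset.univ) fun x hx =>
      Finset.mem_product.2 ⟨Finset.mem_singleton.2 (hfst x hx), Finset.mem_univ _⟩
    simpa using this

end Necklace

/-! ### Planarity of the necklaces -/

section NecklaceDrawing

/-- The segments `p q` and `r t` are separated by a vertical line, or by the horizontal axis, which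
contains `p q`. -/
def IsSeparated (p q r t : ℕ × ℕ) : Prop :=
  (p.1 ≤ q.1 ∧ q.1 ≤ r.1 ∧ r.1 ≤ t.1 ∧ p.1 < t.1) ∨ (p.2 = 0 ∧ q.2 = 0 ∧ (0 < r.2 ∨ 0 < t.2))

theorem IsSeparated.inter_subset {p q r t : ℕ × ℕ} (h : IsSeparated p q r t) :
    segment ℝ (toPlane p) (toPlane q) ∩ segment ℝ (toPlane r) (toPlane t) ⊆
      {toPlane p, toPlane q} ∪ {toPlane r, toPlane t} := by
  rcases h with ⟨hpq, hqr, hrt, hpt⟩ | ⟨hp, hq, hrt⟩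
  · rify at hpq hqr hrt
    rcases hqr.trans hrt |>.lt_or_eq with h | h
    · rw [Set.inter_comm]
      refine (segment_inter_subset_of_line 1 0 (-q.1 : ℝ) ?_ ?_ (Or.inr ?_) ?_ ?_).trans
        Set.subset_union_right <;> simp only [toPlane] <;> linarith
    · rify at hpt
      refine (segment_inter_subset_of_line (-1) 0 (q.1 : ℝ) ?_ ?_ (Or.inl ?_) ?_ ?_).trans
        Set.subset_union_left <;> simp only [toPlane] <;> linarith
  · rw [Set.inter_comm]
    refine (segment_inter_subset_of_line 0 1 0 ?_ ?_ ?_ ?_ ?_).trans Set.subset_union_right <;>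
      simp [toPlane, hp, hq, hrt]

theorem fst_eq_of_mem_segment {p q r : ℕ × ℕ} (h : toPlane r ∈ segment ℝ (toPlane p) (toPlane q))
    (hpq : p.1 = q.1) : r.1 = p.1 := by
  obtain ⟨a, b, -, -, hab, hr⟩ := h
  have h1 := congrArg Prod.fst hr
  simp only [toPlane, Prod.fst_add, Prod.smul_fst, smul_eq_mul, ← hpq, ← add_mul, hab,
    one_mul] at h1
  exact_mod_cast h1.symm

theorem snd_eq_zero_of_mem_segment {p q r : ℕ × ℕ}
    (h : toPlane r ∈ segment ℝ (toPlane p) (toPlane q)) (hp : p.2 = 0) (hq : q.2 = 0) :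
    r.2 = 0 := by
  obtain ⟨a, b, -, -, hab, hr⟩ := h
  have h1 := congrArg Prod.snd hr
  simp only [toPlane, Prod.snd_add, Prod.smul_snd, smul_eq_mul, hp, hq] at h1
  simpa using h1.symm

theorem eq_or_eq_of_mem_segment {p q r : ℕ × ℕ}
    (h : toPlane r ∈ segment ℝ (toPlane p) (toPlane q)) (hpq : p.1 + 1 = q.1) :
    r = p ∨ r = q := by
  obtain ⟨a, b, ha, hb, hab, hr⟩ := h
  have h1 := congrArg Prod.fst hr
  simp only [toPlane, Prod.fst_add, Prod.smul_fst, smul_eq_mul, ← hpq] at h1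
  push_cast at h1
  have h2 : (r.1 : ℝ) = p.1 + b := by linear_combination -h1 + (p.1 : ℝ) * hab
  have h3 : p.1 ≤ r.1 := by rify; linarith
  have h4 : r.1 ≤ p.1 + 1 := by rify; linarith
  rcases (show r.1 = p.1 ∨ r.1 = p.1 + 1 by omega) with h5 | h5
  · left
    obtain rfl : b = 0 := by rw [h5] at h2; linarith
    obtain rfl : a = 1 := by linarith
    exact toPlane_injective (by simpa using hr.symm)
  · right
    obtain rfl : b = 1 := by rw [h5] at h2; push_cast at h2; linarith
    obtain rfl : a = 0 := by linarith
    exact toPlane_injective (by simpa using hr.symm)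

/-- The edges of the necklace, oriented from left to right except for the edge that closes the
necklace. -/
inductive NecklaceEdge {m : ℕ} : Fin m × Fin 4 → Fin m × Fin 4 → Prop
  | zero_one (j : Fin m) : NecklaceEdge (j, 0) (j, 1)
  | zero_two (j : Fin m) : NecklaceEdge (j, 0) (j, 2)
  | one_two (j : Fin m) : NecklaceEdge (j, 1) (j, 2)
  | one_three (j : Fin m) : NecklaceEdge (j, 1) (j, 3)
  | two_three (j : Fin m) : NecklaceEdge (j, 2) (j, 3)
  | link (i j : Fin m) (h : j.val = i.val + 1) : NecklaceEdge (i, 3) (j, 0)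
  | close (i j : Fin m) (hi : i.val + 1 = m) (hj : j.val = 0) : NecklaceEdge (i, 3) (j, 0)

/-- The diamonds are drawn from left to right. The first vertex and the last one are the only
vertices on the line `y = 0`, which contains the edge that closes the necklace. -/
def necklacePoint {m : ℕ} (v : Fin m × Fin 4) : ℕ × ℕ :=
  (3 * v.1.val + ![0, 1, 1, 2] v.2,
    ![if v.1.val = 0 then 0 else 5, 6, 4, if v.1.val + 1 = m then 0 else 5] v.2)

variable {m : ℕ}

theorem necklacePoint_injective : Function.Injective (necklacePoint (m := m)) := by
  rintro ⟨j, i⟩ ⟨j', i'⟩ h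
  rw [necklacePoint, necklacePoint, Prod.mk.injEq] at h
  obtain ⟨h1, h2⟩ := h
  have hj : j.val = j'.val := by
    fin_cases i <;> fin_cases i' <;> simp at h1 <;> omega
  obtain rfl := Fin.ext hj
  fin_cases i <;> fin_cases i' <;> simp at h1 h2 ⊢

theorem NecklaceEdge.mem_segment {u v w : Fin m × Fin 4} (h : NecklaceEdge u v)
    (hw : toPlane (necklacePoint w) ∈
      segment ℝ (toPlane (necklacePoint u)) (toPlane (necklacePoint v))) : w = u ∨ w = v := by
  suffices hs : (necklacePoint u).1 + 1 = (necklacePoint v).1 ∨ w = u ∨ w = v by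
    rcases hs with hs | hs
    · exact (eq_or_eq_of_mem_segment hw hs).imp (fun h => necklacePoint_injective h)
        fun h => necklacePoint_injective h
    · exact hs
  cases h with
  | one_two j =>
    right
    have h1 := fst_eq_of_mem_segment hw rfl
    obtain ⟨j', i⟩ := w
    simp only [necklacePoint] at h1
    fin_cases i <;> simp [Fin.ext_iff] at h1 ⊢ <;> omega
  | close i j hi hj =>
    right
    have h1 := snd_eq_zero_of_mem_segment hw (by simp [necklacePoint, hi])
      (by simp [necklacePoint, hj])
    obtain ⟨j', i⟩ := w
    simp only [necklacePoint] at h1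
    fin_cases i <;> simp [Fin.ext_iff] at h1 ⊢ <;> omega
  | link i j h =>
    left
    simp [necklacePoint, h]
    omega
  | _ => left; rfl

theorem NecklaceEdge.inter_subset {u v x y : Fin m × Fin 4} (h : NecklaceEdge u v)
    (h' : NecklaceEdge x y) (hne : (u, v) ≠ (x, y)) :
    segment ℝ (toPlane (necklacePoint u)) (toPlane (necklacePoint v)) ∩
        segment ℝ (toPlane (necklacePoint x)) (toPlane (necklacePoint y)) ⊆
      {toPlane (necklacePoint u), toPlane (necklacePoint v)} ∪
        {toPlane (necklacePoint x), toPlane (necklacePoint y)} := by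
  by_cases hs : sideBySide (necklacePoint u) (necklacePoint v) (necklacePoint x)
      (necklacePoint y) = true
  · exact subset_of_sideBySide hs
  suffices hsep : IsSeparated (necklacePoint u) (necklacePoint v) (necklacePoint x)
      (necklacePoint y) ∨ IsSeparated (necklacePoint x) (necklacePoint y) (necklacePoint u)
        (necklacePoint v) by
    rcases hsep with hsep | hsep
    · exact hsep.inter_subset
    · rw [Set.inter_comm, Set.union_comm]
      exact hsep.inter_subset
  cases h <;> cases h' <;>
    simp [IsSeparated, necklacePoint, Fin.ext_iff] at hne ⊢ <;> try omega
  case link.close => split_ifs <;> omega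
  case close.link => split_ifs <;> omega
  -- In the remaining cases, the two edges share an end vertex if they lie in the same diamond.
  all_goals
    rename_i j j'
    by_contra! hj
    obtain rfl : j = j' := by omega
    apply hs
    simp [sideBySide, onLeft, isLeft, necklacePoint, ← Bool.not_eq_true]
    split_ifs <;> omega

theorem necklaceEdge_succ [NeZero m] (u : Fin m × Fin 4) :
    NecklaceEdge u (blockSucc m 4 u) ∨ NecklaceEdge (blockSucc m 4 u) u := by
  left
  obtain ⟨j, i⟩ := u
  fin_cases i
  · exact .zero_one j
  · exact .one_two j
  · exact .two_three j
  · change NecklaceEdge (j, 3) (j + 1, 0)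
    by_cases hj : j.val + 1 = m
    · refine .close _ _ hj ?_
      rw [Fin.val_add, Nat.add_mod, Fin.val_one', Nat.mod_mod, ← Nat.add_mod, hj, Nat.mod_self]
    · refine .link _ _ ?_
      rw [Fin.val_add_one_of_lt' (by omega)]

theorem necklaceEdge_chord (u : Fin m × Fin 4) :
    NecklaceEdge u (necklaceChord u) ∨ NecklaceEdge (necklaceChord u) u := by
  obtain ⟨j, i⟩ := u
  fin_cases i
  · exact Or.inl (.zero_two j)
  · exact Or.inl (.one_three j)
  · exact Or.inr (.zero_two j)
  · exact Or.inr (.one_three j)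

theorem isPlanar_necklace [NeZero m] : IsPlanar (necklace m) := by
  refine isPlanar_of_segments (fun v => toPlane (necklacePoint v))
    (toPlane_injective.comp necklacePoint_injective) NecklaceEdge
    (chordGraph_orientation necklaceEdge_succ necklaceEdge_chord)
    (fun u v w h hw => h.mem_segment hw) fun u v x y h h' hne => ?_
  refine (h.inter_subset h' hne).trans ?_
  rintro z ((rfl | rfl) | (rfl | rfl)) <;> exact ⟨_, rfl⟩

end NecklaceDrawing

/-! ### Gaps -/

section Gaps

/-- A planar Hamiltonian cubic graph realizes each gap below its order. -/
theorem exists_isGap {V : Type} [Fintype V] [DecidableEq V] [Nonempty V] {s : Equiv.Perm V}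
    {f : V → V} (h : IsChordData s f) (hplanar : IsPlanar (chordGraph s f)) {a b : ℕ}
    (hspec : ∀ n ∈ cycleSpectrum (chordGraph s f), n < a ∨ b < n) (hb : b < Fintype.card V) :
    ∃ (V : Type) (_ : Fintype V) (G : SimpleGraph V) (_ : DecidableRel G.Adj),
      IsKConnected 2 G ∧ G.IsRegularOfDegree 3 ∧ IsPlanar G ∧ IsGap G a b := by
  refine ⟨V, inferInstance, chordGraph s f, inferInstance, h.isKConnected, h.isRegularOfDegree,
    hplanar, Set.eq_empty_of_forall_notMem ?_, hb.trans_le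
      (le_circumference h.card_mem_cycleSpectrum)⟩
  rintro n ⟨hn, han, hnb⟩
  rcases hspec n hn with h | h <;> omega

end Gaps

end CycleGaps

theorem mainTheorem2 (a b : ℕ) (ha : 3 ≤ a) (hab : a ≤ b) :
    (∃ (V : Type) (_ : Fintype V) (G : SimpleGraph V) (_ : DecidableRel G.Adj),
      CycleGaps.IsKConnected 2 G ∧ G.IsRegularOfDegree 3 ∧ CycleGaps.IsPlanar G ∧
        CycleGaps.IsGap G a b) ↔
      (a = 3 ∧ b ≤ 4) ∨ (a = 4 ∧ b ≤ 9) ∨ 5 ≤ a := by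
  constructor
  · rintro ⟨V, _, G, _, hconn, hreg, hplanar, hgap⟩
    have h := CycleGaps.not_isGap_of_lt hplanar hreg hconn hgap
    omega
  · rintro (⟨rfl, hb⟩ | ⟨rfl, hb⟩ | h)
    · refine CycleGaps.exists_isGap CycleGaps.dodeca_isChordData CycleGaps.isPlanar_dodecahedron
        (fun n hn => Or.inr ?_) ?_
      · have := CycleGaps.five_le_of_mem_cycleSpectrum_dodecahedron hn
        omega
      · rw [Fintype.card_fin]
        omega
    · refine CycleGaps.exists_isGap CycleGaps.trunc_isChordData
        CycleGaps.isPlanar_truncDodecahedron (fun n hn => ?_) ?_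
      · have := CycleGaps.le_or_le_of_mem_cycleSpectrum_truncDodecahedron hn
        omega
      · rw [Fintype.card_prod, Fintype.card_fin, Fintype.card_fin]
        omega
    · refine CycleGaps.exists_isGap (CycleGaps.necklace_isChordData (m := b + 1))
        CycleGaps.isPlanar_necklace (fun n hn => ?_) ?_
      · have := CycleGaps.le_or_le_of_mem_cycleSpectrum_necklace hn
        omega
      · rw [Fintype.card_prod, Fintype.card_fin, Fintype.card_fin]
        omega
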